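/- **Setting.** A *periodic triangulation* $\mathcal T$ of the plane is a locally finite triangulation of $\mathbb R^2$ (the image of a simplicial complex filling the plane under a homeomorphism of the plane) that is invariant under two linearly independent translations. Its vertex set is $\mathcal V\subset\mathbb R^2$, and $v\sim v'$ means that $v,v'$ are joined by an edge. $\mathcal T$ is *symmetric* if moreover $\mathcal V\subset\mathbb Z^2$ and $\mathcal T$ is invariant under the rotation of angle $\pi/2$ around $0$ and under the horizontal reflection. A *random coloring* is a random function $f:\mathcal V\to\{\pm1\}$; it is *symmetric* if its law is invariant under all symmetries of $\mathcal T$ (isometries of the plane preserving $\mathcal T$) and under $f\mapsto -f$; it is *$\ell$-dependent* if $f_{|A}$ and $f_{|B}$ are independent whenever $A,B\subset\mathcal V$ are at graph distance at least $\ell$. For real $0<\ell<n$, $\theta_f(n,\ell)$ denotes the smallest total variation distance between the restrictions to $\Lambda_n=[-n,n]^2$ of $f$ and of a symmetric $\ell$-dependent random coloring. The *Ising model* on $\mathcal T$ at inverse temperature $\beta\in\mathbb R$ is given, for finite $\Lambda\subset\mathcal V$ and boundary condition $\omega\in\{\pm1\}^{\mathcal V}$, by the measures $$\mu^\omega_{\Lambda,\beta}[\{\sigma\}]=\frac1{Z^\omega_{\Lambda,\beta}}\exp\Big(\beta\sum_{\{i,j\}\subset\Lambda,\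 i\sim j}\sigma_i\sigma_j+\beta\sum_{i\in\Lambda,\ j\notin\Lambda,\ i\sim j}\sigma_i\omega_j\Big),\qquad \sigma\in\{\pm1\}^\Lambda,$$ and an *infinite-volume Gibbs measure* is a probability measure $\mu$ on $\{\pm1\}^{\mathcal V}$ satisfying the DLR equations: for every finite $\Lambda$, replacing the configuration in $\Lambda$ by a sample from $\mu^\omega_{\Lambda,\beta}$, where $\omega$ has law $\mu$, leaves $\mu$ unchanged. **Theorem.** Let $\mathcal T$ be a periodic triangulation of the plane, $N$ the maximum degree of its vertices, and $\beta_0>0$ such that $N\tanh(\beta_0N)<1$. Then: 1. For every $\beta\in[-\beta_0,\beta_0]$ the Ising model on $\mathcal T$ at inverse temperature $\beta$ has a unique infinite-volume Gibbs measure $\mu_\beta$; in particular, if $\mathcal T$ is symmetric, then so is the random coloring of law $\mu_\beta$. 2. Let $c=-\frac12\log\big(N\tanh(\beta_0N)\big)$. Then $c>0$, and there is a constant $C<\infty$ such that for all $\beta\in[-\beta_0,\beta_0]$ and all real $0<\ell<n$, $$\theta_{\mu_\beta}(n,\ell)\le C\,n^2e^{-c\ell}.$$ -/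

import Mathlib

open MeasureTheory ProbabilityTheory

/-- The Euclidean plane. -/
abbrev Plane : Type := EuclideanSpace ℝ (Fin 2)

/-- The image of a set of cells under a map of the plane. -/
def moveCells (g : Plane → Plane) (cells : Set (Set Plane)) : Set (Set Plane) :=
  (fun c : Set Plane => g '' c) '' cells

/-- The closed cells (vertices, edges, triangles) of the image under a homeomorphism `h` of the
plane of a geometric simplicial complex `K`. -/
def cellsOf (K : Geometry.SimplicialComplex ℝ Plane) (h : Plane ≃ₜ Plane) : Set (Set Plane) :=
  {c | ∃ s ∈ K.faces, c = h '' convexHull ℝ (s : Set Plane)}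

/-- A periodic triangulation of the plane: a simplicial complex filling the plane, drawn by means
of a homeomorphism of the plane (the identity if the edges are straight segments), which is locally
finite and invariant under two linearly independent translations. -/
structure PeriodicTriangulation where
  complex : Geometry.SimplicialComplex ℝ Plane
  drawing : Plane ≃ₜ Plane
  space_eq : complex.space = Set.univ
  locallyFinite : ∀ B : Set Plane, Bornology.IsBounded B →
    {c ∈ cellsOf complex drawing | (c ∩ B).Nonempty}.Finite
  periodic : ∃ a b : Plane, LinearIndependent ℝ ![a, b] ∧
    moveCells (fun x => a + x) (cellsOf complex drawing) = cellsOf complex drawing ∧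
    moveCells (fun x => b + x) (cellsOf complex drawing) = cellsOf complex drawing

namespace PeriodicTriangulation

/-- The closed cells of the triangulation, as subsets of the plane. -/
def cells (T : PeriodicTriangulation) : Set (Set Plane) := cellsOf T.complex T.drawing

/-- The vertex set of the triangulation: the points of the plane that are cells. -/
abbrev Vertex (T : PeriodicTriangulation) : Type := {x : Plane // {x} ∈ T.cells}

/-- The graph of the triangulation: two distinct vertices are adjacent if they are the end-points
of an edge of the triangulation. -/
def graph (T : PeriodicTriangulation) : SimpleGraph T.Vertex where
  Adj x y := x ≠ y ∧
    ∃ s ∈ T.complex.faces, T.drawing '' (s : Set Plane) = {(x : Plane), (y : Plane)}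
  symm := ⟨fun x y ⟨hxy, s, hs, h⟩ => ⟨hxy.symm, s, hs, by rw [h, Set.pair_comm]⟩⟩
  loopless := ⟨fun _ h => h.1 rfl⟩

/-- `N` is the maximum degree of the vertices of `T`. -/
def IsMaxDegree (T : PeriodicTriangulation) (N : ℕ) : Prop :=
  IsGreatest (Set.range fun v : T.Vertex => (T.graph.neighborSet v).encard) (N : ℕ∞)

/-! ### Symmetries -/

/-- `T` is invariant under the map `g` of the plane. -/
def InvariantUnder (T : PeriodicTriangulation) (g : Plane → Plane) : Prop :=
  moveCells g T.cells = T.cells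

/-- A triangulation is symmetric if its vertices lie in `ℤ²` and if (besides being periodic) it is
invariant under the rotation of angle `π/2` around `0` and under the horizontal reflection. -/
def IsSymmetric (T : PeriodicTriangulation) : Prop :=
  (∀ v : T.Vertex, ∃ a b : ℤ, (v : Plane) = !₂[(a : ℝ), (b : ℝ)]) ∧
  T.InvariantUnder (fun x => !₂[-x 1, x 0]) ∧
  T.InvariantUnder (fun x => !₂[-x 0, x 1])

/-- The action on vertices of a map of the plane under which `T` is invariant. -/
def moveVertex (T : PeriodicTriangulation) (g : Plane → Plane) (hg : T.InvariantUnder g)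
    (v : T.Vertex) : T.Vertex :=
  ⟨g v.1, by
    have h : g '' {v.1} ∈ moveCells g T.cells := ⟨{v.1}, v.2, rfl⟩
    rw [hg, Set.image_singleton] at h
    exact h⟩

/-! ### Random colorings -/

/-- Configurations: colorings of the vertices by `±1`. A random coloring is represented by its
law, a probability measure on this space (with the product σ-algebra). -/
abbrev Config (T : PeriodicTriangulation) : Type := T.Vertex → ℤˣ

/-- A random coloring of law `μ` is symmetric if it is invariant in distribution under the
symmetries of `T`, that is the isometries of the plane preserving `T`, and under sign change. -/
def IsSymmetricModel (T : PeriodicTriangulation) (μ : Measure T.Config) : Prop :=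
  (∀ (g : Plane ≃ᵢ Plane) (hg : T.InvariantUnder g),
    μ.map (fun (ω : T.Config) (v : T.Vertex) => ω (T.moveVertex g hg v)) = μ) ∧
  μ.map (fun ω : T.Config => -ω) = μ

/-- `ℓ`-dependence: the restrictions to two vertex sets at graph distance at least `ℓ` from each
other are independent. -/
def IsDependent (T : PeriodicTriangulation) (ℓ : ℝ) (μ : Measure T.Config) : Prop :=
  ∀ A B : Set T.Vertex, (∀ a ∈ A, ∀ b ∈ B, ℓ ≤ (T.graph.dist a b : ℝ)) →
    IndepFun (A.domRestrict : T.Config → A → ℤˣ) (B.domRestrict : T.Config → B → ℤˣ) μ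

end PeriodicTriangulation

/-- Total variation distance `sup_A |μ(A) - ν(A)|` of two probability measures. -/
noncomputable def tvDist {α : Type*} [MeasurableSpace α] (μ ν : Measure α) : ℝ :=
  ⨆ A : {A : Set α // MeasurableSet A}, |μ.real A.1 - ν.real A.1|

namespace PeriodicTriangulation

/-- The vertices in the box `Λ_n = [-n, n]²`. -/
def box (T : PeriodicTriangulation) (n : ℝ) : Set T.Vertex :=
  {v | ∀ i : Fin 2, |(v : Plane) i| ≤ n}

/-- `θ(n, ℓ)`: the smallest total variation distance between the restrictions to `Λ_n` of the
coloring of law `μ` and of a symmetric `ℓ`-dependent random coloring. -/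
noncomputable def theta (T : PeriodicTriangulation) (μ : Measure T.Config) (n ℓ : ℝ) : ℝ :=
  sInf {d : ℝ | ∃ ν : Measure T.Config, IsProbabilityMeasure ν ∧ T.IsSymmetricModel ν ∧
    T.IsDependent ℓ ν ∧
    d = tvDist (μ.map ((T.box n).domRestrict : T.Config → T.box n → ℤˣ))
          (ν.map ((T.box n).domRestrict : T.Config → T.box n → ℤˣ))}

/-! ### The Ising model -/

/-- The configuration equal to `σ` in `Λ` and to `ω` outside of `Λ`. -/
noncomputable def glue (T : PeriodicTriangulation) (Λ : Finset T.Vertex) (σ : Λ → ℤˣ)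
    (ω : T.Config) : T.Config :=
  open Classical in fun v => if h : v ∈ Λ then σ ⟨v, h⟩ else ω v

/-- The Hamiltonian in the finite region `Λ` with boundary condition `ω`. Every edge inside `Λ`
is counted once, whence the factor `1/2` before the sum over ordered pairs. -/
noncomputable def hamiltonian (T : PeriodicTriangulation) (Λ : Finset T.Vertex) (ω : T.Config)
    (σ : Λ → ℤˣ) : ℝ :=
  open Classical in
  - ((1 / 2 : ℝ) * ∑ i : Λ, ∑ j : Λ,
      if T.graph.Adj i j then ((σ i : ℤ) : ℝ) * ((σ j : ℤ) : ℝ) else 0)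
  - ∑ i : Λ, ∑ᶠ j ∈ {j : T.Vertex | j ∉ Λ ∧ T.graph.Adj i j},
      ((σ i : ℤ) : ℝ) * ((ω j : ℤ) : ℝ)

/-- The partition function. -/
noncomputable def partitionFunction (T : PeriodicTriangulation) (β : ℝ) (Λ : Finset T.Vertex)
    (ω : T.Config) : ℝ :=
  open Classical in ∑ σ : Λ → ℤˣ, Real.exp (-β * T.hamiltonian Λ ω σ)

/-- The Ising measure on `{-1, 1}^Λ` with boundary condition `ω` at inverse temperature `β`. -/
noncomputable def isingMeasure (T : PeriodicTriangulation) (β : ℝ) (Λ : Finset T.Vertex)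
    (ω : T.Config) : Measure (Λ → ℤˣ) :=
  open Classical in
  ∑ σ : Λ → ℤˣ, ENNReal.ofReal
    (Real.exp (-β * T.hamiltonian Λ ω σ) / T.partitionFunction β Λ ω) • Measure.dirac σ

/-- Infinite-volume Gibbs measures of the Ising model on `T` at inverse temperature `β`: the
probability measures satisfying the Dobrushin–Lanford–Ruelle equations, i.e. which do not change
when the configuration in a finite region is resampled from the Ising measure given the
configuration outside. -/
def IsGibbs (T : PeriodicTriangulation) (β : ℝ) (μ : Measure T.Config) : Prop :=
  IsProbabilityMeasure μ ∧
  ∀ (Λ : Finset T.Vertex) (A : Set T.Config), MeasurableSet A →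
    ∫⁻ ω, T.isingMeasure β Λ ω {σ | T.glue Λ σ ω ∈ A} ∂μ = μ A

end PeriodicTriangulation

/-! ### Geometry of periodic triangulations -/

namespace PeriodicTriangulation

variable (T : PeriodicTriangulation)

/-! The Gibbs measure is realised as the stationary law of a discrete-time Glauber dynamics. At each
time every vertex tosses a fair clock, and it is updated if its clock rings and no neighbouring
clock does; the updated vertices thus form an independent set, and the DLR equations for finite
independent sets make every Gibbs measure invariant (`IsGibbs.heatBathInvariant`,
`HeatBathInvariant.map_run`).

A heat bath update in the local field `h` looks at the neighbours only if a uniform variable falls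
below `|tanh h|`, which is at most `p = tanh(β₀N)`; otherwise it outputs a fair sign. Tracing a spin
back in time is therefore dominated by a branching process with mean offspring at most `Np < 1`.
Cutting this exploration after `k` generations gives `factor`, a function of the noise within graph
distance `k`. Its law has finite range (`indepFun_factor`), and it inherits the symmetries of the
i.i.d. noise, since the construction commutes with graph automorphisms and with a global sign
change.

With the same noise, the truncated dynamics and the dynamics from any initial state differ at a
given vertex with probability at most `(Np)^k + λ^t`, where `λ < 1` is `mixingRate`
(`measure_factor_ne_run_le`). Started from a Gibbs measure the dynamics keeps that law, so a union
bound compares the Gibbs measure with the law of `factor` on any finite set of vertices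
(`HeatBathInvariant.abs_sub_factor_le`).

Letting `k = t` tend to infinity gives uniqueness and symmetry. Existence follows from compactness
of the configuration space and continuity of the finite-volume kernels. For the bound on `theta`,
`k` is taken just below `ℓ/2`, `t` very large, and periodicity bounds the number of vertices in the
box by a multiple of `(n + 1)²`. For small `n` this must be improved: the box then has at most one
vertex, whose spin is a fair sign under every symmetric law, and `theta` is at most `0`. -/

lemma singleton_mem_cells_iff {x : Plane} :
    {x} ∈ T.cells ↔ {T.drawing.symm x} ∈ T.complex.faces := by
  constructor
  · rintro ⟨s, hs, h⟩
    have hsub : ∀ a ∈ s, a = T.drawing.symm x := fun a ha => by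
      have : T.drawing a ∈ T.drawing '' convexHull ℝ (s : Set Plane) :=
        ⟨a, subset_convexHull ℝ _ ha, rfl⟩
      rw [← h, Set.mem_singleton_iff] at this
      rw [← this, Homeomorph.symm_apply_apply]
    have := (Finset.eq_singleton_iff_nonempty_unique_mem).2
      ⟨T.complex.nonempty_of_mem_faces hs, hsub⟩
    rwa [← this]
  · exact fun h => ⟨_, h, by simp⟩

/-- The vertices in a closed cell are the images of the vertices of the simplex. -/
lemma vertices_of_cell {s : Finset Plane} (hs : s ∈ T.complex.faces) :
    {v : Plane | {v} ∈ T.cells ∧ v ∈ T.drawing '' convexHull ℝ (s : Set Plane)} =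
      T.drawing '' (s : Set Plane) := by
  ext v
  constructor
  · rintro ⟨hv, a, ha, rfl⟩
    rw [singleton_mem_cells_iff, Homeomorph.symm_apply_apply] at hv
    exact ⟨a, (T.complex.vertex_mem_convexHull_iff hv hs).1 ha, rfl⟩
  · rintro ⟨a, ha, rfl⟩
    refine ⟨?_, a, subset_convexHull ℝ _ ha, rfl⟩
    rw [singleton_mem_cells_iff, Homeomorph.symm_apply_apply]
    exact T.complex.down_closed hs (Finset.singleton_subset_iff.2 ha) (Finset.singleton_nonempty a)

/-- Adjacency is read off from the set of cells alone. This is what symmetries need: they preserve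
the cells, but not necessarily the chosen complex and drawing. -/
lemma adj_iff {x y : T.Vertex} :
    T.graph.Adj x y ↔ x ≠ y ∧
      ∃ c ∈ T.cells, {v : Plane | {v} ∈ T.cells ∧ v ∈ c} = {(x : Plane), (y : Plane)} := by
  refine and_congr_right fun _ => ⟨?_, ?_⟩
  · rintro ⟨s, hs, h⟩
    exact ⟨_, ⟨s, hs, rfl⟩, (T.vertices_of_cell hs).trans h⟩
  · rintro ⟨_, ⟨s, hs, rfl⟩, h⟩
    exact ⟨s, hs, (T.vertices_of_cell hs).symm.trans h⟩

/-! #### Symmetries -/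

variable {T}

lemma InvariantUnder.image_mem_cells_iff {g : Plane ≃ Plane} (hg : T.InvariantUnder g)
    {c : Set Plane} : g '' c ∈ T.cells ↔ c ∈ T.cells := by
  constructor
  · intro h
    rw [← hg] at h
    obtain ⟨d, hd, hdc⟩ := h
    rwa [← g.injective.image_injective hdc]
  · intro h
    have : g '' c ∈ moveCells g T.cells := ⟨c, h, rfl⟩
    rwa [hg] at this

lemma InvariantUnder.symm {g : Plane ≃ Plane} (hg : T.InvariantUnder g) :
    T.InvariantUnder g.symm := by
  ext c
  constructor
  · rintro ⟨d, hd, rfl⟩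
    rw [← hg.image_mem_cells_iff]
    simpa using hd
  · intro hc
    exact ⟨g '' c, hg.image_mem_cells_iff.2 hc, by simp⟩

/-- The graph automorphism induced by a bijection of the plane that preserves `T`. -/
def moveVertexIso (g : Plane ≃ Plane) (hg : T.InvariantUnder g) : T.graph ≃g T.graph where
  toFun := T.moveVertex g hg
  invFun := T.moveVertex g.symm hg.symm
  left_inv v := Subtype.ext (g.symm_apply_apply v)
  right_inv v := Subtype.ext (g.apply_symm_apply v)
  map_rel_iff' {x y} := by
    have hpair : ({g x, g y} : Set Plane) = g '' {(x : Plane), (y : Plane)} :=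
      (Set.image_pair g _ _).symm
    have hset : ∀ c : Set Plane, {v : Plane | {v} ∈ T.cells ∧ v ∈ g '' c} =
        g '' {v : Plane | {v} ∈ T.cells ∧ v ∈ c} := fun c => by
      ext v
      constructor
      · rintro ⟨hv, a, ha, rfl⟩
        refine ⟨a, ⟨?_, ha⟩, rfl⟩
        rwa [← hg.image_mem_cells_iff, Set.image_singleton]
      · rintro ⟨a, ⟨hv, ha⟩, rfl⟩
        refine ⟨?_, a, ha, rfl⟩
        rwa [← hg.image_mem_cells_iff, Set.image_singleton] at hv
    have hne : T.moveVertex g hg x ≠ T.moveVertex g hg y ↔ x ≠ y := not_congr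
      ⟨fun h => Subtype.ext (g.injective (congrArg Subtype.val h)), fun h => by rw [h]⟩
    simp only [Equiv.coe_fn_mk, adj_iff]
    refine and_congr hne ⟨?_, ?_⟩
    · rintro ⟨c, hc, h⟩
      have hc' : c = g '' (g.symm '' c) := by simp
      refine ⟨g.symm '' c, hg.symm.image_mem_cells_iff.2 hc, ?_⟩
      rw [hc', hset] at h
      exact g.injective.image_injective (h.trans hpair)
    · rintro ⟨c, hc, h⟩
      refine ⟨g '' c, hg.image_mem_cells_iff.2 hc, ?_⟩
      rw [hset, h]
      exact hpair.symm

/-! #### Finiteness -/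

variable (T)

lemma finite_vertices {B : Set Plane} (hB : Bornology.IsBounded B) :
    {v : T.Vertex | (v : Plane) ∈ B}.Finite := by
  refine Set.Finite.of_finite_image (f := fun v : T.Vertex => ({(v : Plane)} : Set Plane))
    ((T.locallyFinite B hB).subset ?_) ?_
  · rintro _ ⟨v, hv, rfl⟩
    exact ⟨v.2, v, rfl, hv⟩
  · intro v _ w _ h
    exact Subtype.ext (Set.singleton_injective h)

lemma norm_le_of_mem_box {n : ℝ} {v : T.Vertex} (hv : v ∈ T.box n) : ‖(v : Plane)‖ ≤ 2 * n := by
  have h0 : 0 ≤ n := (abs_nonneg _).trans (hv 0)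
  have h := EuclideanSpace.norm_sq_eq (v : Plane)
  simp only [Fin.sum_univ_two, Real.norm_eq_abs] at h
  have h1 := hv 0
  have h2 := hv 1
  nlinarith [abs_nonneg ((v : Plane) 0), abs_nonneg ((v : Plane) 1), norm_nonneg (v : Plane)]

lemma finite_box (n : ℝ) : (T.box n).Finite :=
  (T.finite_vertices (Metric.isBounded_closedBall (x := (0 : Plane)) (r := 2 * n))).subset
    fun v hv => by simpa using T.norm_le_of_mem_box hv

lemma exists_mem_box (v : T.Vertex) : ∃ n : ℕ, v ∈ T.box n := by
  obtain ⟨n, hn⟩ := exists_nat_ge ‖(v : Plane)‖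
  exact ⟨n, fun i => (PiLp.norm_apply_le (v : Plane) i).trans hn⟩

instance : Countable T.Vertex := by
  rw [← Set.countable_univ_iff]
  refine Set.Countable.mono (fun v _ => Set.mem_iUnion.2 (T.exists_mem_box v))
    (Set.countable_iUnion fun n : ℕ => (T.finite_box n).countable)

/-- Small boxes contain at most the vertex `0`. -/
lemma exists_subsingleton_box : ∃ r > 0, ∀ n < r, (T.box n).Subsingleton := by
  have hfin : ((fun v : T.Vertex => (v : Plane)) '' {v | v ∈ T.box 1 ∧ (v : Plane) ≠ 0}).Finite :=
    ((T.finite_box 1).subset fun v hv => hv.1).image _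
  obtain ⟨ε, hε, hball⟩ := Metric.isOpen_iff.1 hfin.isClosed.isOpen_compl 0
    (by rintro ⟨v, hv, h⟩; exact hv.2 h)
  -- The half accounts for the bound `2 * n` on the norm of a vertex of the box; the `1` keeps the
  -- box inside the one where the nonzero vertices were removed.
  refine ⟨min 1 (ε / 2), lt_min one_pos (half_pos hε), fun n hn => ?_⟩
  have hzero : ∀ v ∈ T.box n, (v : Plane) = 0 := fun v hv => by
    by_contra hne
    refine hball (a := (v : Plane)) ?_ ⟨v, ⟨fun i => ?_, hne⟩, rfl⟩
    · rw [mem_ball_zero_iff]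
      have := T.norm_le_of_mem_box hv
      linarith [hn.trans_le (min_le_right _ _)]
    · exact (hv i).trans (hn.trans_le (min_le_left _ _)).le
  exact fun v hv w hw => Subtype.ext ((hzero v hv).trans (hzero w hw).symm)

/-- The translations that preserve the vertex set. -/
def vertexPeriods : AddSubgroup Plane where
  carrier := {a | ∀ x, {a + x} ∈ T.cells ↔ {x} ∈ T.cells}
  add_mem' {a b} ha hb x := by rw [add_assoc, ha, hb]
  zero_mem' x := by rw [zero_add]
  neg_mem' {a} ha x := by rw [← ha, add_neg_cancel_left]

lemma mem_vertexPeriods {a : Plane} (h : moveCells (fun x => a + x) T.cells = T.cells) :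
    a ∈ T.vertexPeriods := fun x => by
  have := InvariantUnder.image_mem_cells_iff (g := Equiv.addLeft a) h (c := {x})
  rwa [Set.image_singleton] at this

/-- The number of vertices in a box is at most quadratic. -/
lemma exists_ncard_box_le : ∃ K : ℝ, 0 ≤ K ∧ ∀ n : ℝ, 0 ≤ n →
    ((T.box n).ncard : ℝ) ≤ K * (n + 1) ^ 2 := by
  obtain ⟨a, b, hab, ha, hb⟩ := T.periodic
  let e : Module.Basis (Fin 2) ℝ Plane :=
    basisOfLinearIndependentOfCardEqFinrank hab (by simp)
  have he : ∀ i, e i ∈ T.vertexPeriods := by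
    intro i
    rw [coe_basisOfLinearIndependentOfCardEqFinrank]
    fin_cases i
    · exact T.mem_vertexPeriods ha
    · exact T.mem_vertexPeriods hb
  have hspan : ∀ x ∈ Submodule.span ℤ (Set.range e), x ∈ T.vertexPeriods := by
    have : Submodule.span ℤ (Set.range e) ≤ AddSubgroup.toIntSubmodule T.vertexPeriods :=
      Submodule.span_le.2 (by rintro _ ⟨i, rfl⟩; exact he i)
    exact fun x hx => this hx
  -- Vertices are reduced modulo the period lattice: each is determined by a vertex in the bounded
  -- fundamental domain and two integer coordinates.
  have hfract : ∀ v : T.Vertex, {ZSpan.fract e (v : Plane)} ∈ T.cells := fun v => by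
    rw [← hspan _ (ZSpan.floor e (v : Plane)).2, ZSpan.fract_apply, add_sub_cancel]
    exact v.2
  have hD := T.finite_vertices (ZSpan.fundamentalDomain_isBounded e)
  set D := {v : T.Vertex | (v : Plane) ∈ ZSpan.fundamentalDomain e}
  obtain ⟨M, hM0, hM⟩ : ∃ M : ℝ, 0 ≤ M ∧ ∀ (x : Plane) (i : Fin 2), |e.repr x i| ≤ M * ‖x‖ := by
    let f : Plane →L[ℝ] (Fin 2 → ℝ) := LinearMap.toContinuousLinearMap e.equivFun
    refine ⟨‖f‖, norm_nonneg f, fun x i => ?_⟩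
    exact (norm_le_pi_norm (f x) i).trans (f.le_opNorm x)
  -- Coordinates in the box are at most `2Mn` in absolute value, so each floor takes at most `2m +
  -- 2` values with `m < 2Mn + 1`, and `4Mn + 4 ≤ (4M + 4)(n + 1)`.
  refine ⟨D.ncard * (4 * M + 4) ^ 2, by positivity, fun n hn => ?_⟩
  set m : ℤ := ⌈2 * M * n⌉ with hm
  have hm0 : 0 ≤ m := Int.ceil_nonneg (by positivity)
  let F : T.Vertex → T.Vertex × ℤ × ℤ := fun v =>
    (⟨ZSpan.fract e (v : Plane), hfract v⟩, ⌊e.repr (v : Plane) 0⌋, ⌊e.repr (v : Plane) 1⌋)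
  have hF : Function.Injective F := fun v w h => by
    simp only [F, Prod.mk.injEq, Subtype.mk.injEq] at h
    refine Subtype.ext (e.repr.injective (Finsupp.ext fun i => ?_))
    have h1 : Int.fract (e.repr (v : Plane) i) = Int.fract (e.repr (w : Plane) i) := by
      rw [← ZSpan.repr_fract_apply, ← ZSpan.repr_fract_apply, h.1]
    have h2 : ⌊e.repr (v : Plane) i⌋ = ⌊e.repr (w : Plane) i⌋ := by
      fin_cases i
      exacts [h.2.1, h.2.2]
    rw [← Int.floor_add_fract (e.repr (v : Plane) i), h1, h2, Int.floor_add_fract]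
  have hmaps : Set.MapsTo F (T.box n)
      (hD.toFinset ×ˢ (Finset.Icc (-m - 1) m ×ˢ Finset.Icc (-m - 1) m) : Finset _) := by
    intro v hv
    have hcoord : ∀ i, ⌊e.repr (v : Plane) i⌋ ∈ Finset.Icc (-m - 1) m := fun i => by
      have h1 : |e.repr (v : Plane) i| ≤ m := by
        refine ((hM v i).trans ?_).trans (Int.le_ceil (2 * M * n))
        have := mul_le_mul_of_nonneg_left (T.norm_le_of_mem_box hv) hM0
        linarith
      rw [abs_le] at h1
      rw [Finset.mem_Icc]
      constructor
      · refine Int.le_floor.2 ?_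
        push_cast
        linarith
      · exact Int.floor_le_iff.2 (by linarith)
    simp only [Finset.coe_product, Set.mem_prod, Finset.mem_coe, Set.Finite.mem_toFinset]
    exact ⟨ZSpan.fract_mem_fundamentalDomain e _, hcoord 0, hcoord 1⟩
  have hcard := Set.ncard_le_ncard_of_injOn F hmaps hF.injOn (Finset.finite_toSet _)
  rw [Set.ncard_coe_finset, Finset.card_product, Finset.card_product, Int.card_Icc,
    ← Set.ncard_eq_toFinset_card D hD] at hcard
  have hIcc : (((m + 1 - (-m - 1)).toNat : ℕ) : ℝ) ≤ (4 * M + 4) * (n + 1) := by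
    have h1 : (((m + 1 - (-m - 1)).toNat : ℕ) : ℤ) = 2 * m + 2 := by
      rw [Int.toNat_of_nonneg (by omega)]
      ring
    have h2 : (((m + 1 - (-m - 1)).toNat : ℕ) : ℝ) = 2 * m + 2 := by exact_mod_cast h1
    have h3 : (m : ℝ) < 2 * M * n + 1 := Int.ceil_lt_add_one _
    rw [h2]
    nlinarith [mul_nonneg hM0 hn]
  calc ((T.box n).ncard : ℝ)
      ≤ D.ncard * (((m + 1 - (-m - 1)).toNat : ℕ) * ((m + 1 - (-m - 1)).toNat : ℕ)) := by
        exact_mod_cast hcard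
    _ ≤ D.ncard * (((4 * M + 4) * (n + 1)) * ((4 * M + 4) * (n + 1))) := by gcongr
    _ = D.ncard * (4 * M + 4) ^ 2 * (n + 1) ^ 2 := by ring

/-! #### Degrees -/

/-- A triangulation of the plane has at least one edge. -/
lemma exists_adj : ∃ x y : T.Vertex, T.graph.Adj x y := by
  -- If all faces were points, every point of the plane would be a vertex, against local finiteness.
  by_cases h : ∀ s ∈ T.complex.faces, ∃ a, s = {a}
  · exfalso
    have hall : ∀ x : Plane, {x} ∈ T.cells := fun x => by
      rw [singleton_mem_cells_iff]
      have hx : T.drawing.symm x ∈ T.complex.space := by rw [T.space_eq]; trivial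
      obtain ⟨s, hs, hxs⟩ := Geometry.SimplicialComplex.mem_space_iff.1 hx
      obtain ⟨a, rfl⟩ := h s hs
      rw [Finset.coe_singleton, convexHull_singleton, Set.mem_singleton_iff] at hxs
      rwa [hxs]
    have hfin := (T.finite_vertices (Metric.isBounded_ball (x := (0 : Plane)) (r := 1))).image
      Subtype.val
    refine infinite_of_mem_nhds (0 : Plane) (Metric.ball_mem_nhds 0 one_pos) (hfin.subset ?_)
    exact fun x hx => ⟨⟨x, hall x⟩, hx, rfl⟩
  · push Not at h
    obtain ⟨s, hs, hne⟩ := h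
    obtain ⟨a, ha⟩ := T.complex.nonempty_of_mem_faces hs
    obtain ⟨b, hb, hab⟩ : ∃ b ∈ s, b ≠ a := by
      by_contra! hcon
      exact hne a (Finset.eq_singleton_iff_unique_mem.2 ⟨ha, hcon⟩)
    classical
    have hv : ∀ c ∈ s, {T.drawing c} ∈ T.cells := fun c hc => by
      rw [singleton_mem_cells_iff, Homeomorph.symm_apply_apply]
      exact T.complex.down_closed hs (Finset.singleton_subset_iff.2 hc)
        (Finset.singleton_nonempty c)
    refine ⟨⟨_, hv a ha⟩, ⟨_, hv b hb⟩, fun h => hab ?_, {a, b},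
      T.complex.down_closed hs ?_ ⟨a, by simp⟩, ?_⟩
    · exact (T.drawing.injective (congrArg Subtype.val h)).symm
    · intro c hc
      rcases Finset.mem_insert.1 hc with rfl | hc
      · exact ha
      · rwa [Finset.mem_singleton.1 hc]
    · rw [Finset.coe_pair, Set.image_pair]

variable {T} {N : ℕ}

lemma IsMaxDegree.encard_le (hN : T.IsMaxDegree N) (v : T.Vertex) :
    (T.graph.neighborSet v).encard ≤ N := hN.2 ⟨v, rfl⟩

/-- Ensures that `N tanh(β₀N)` is positive; with the convention `log 0 = 0`, the rate `c` would
otherwise vanish. -/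
lemma IsMaxDegree.one_le (hN : T.IsMaxDegree N) : 1 ≤ N := by
  obtain ⟨x, y, hxy⟩ := T.exists_adj
  have h1 : 1 ≤ (T.graph.neighborSet x).encard :=
    Set.one_le_encard_iff_nonempty.2 ⟨y, hxy⟩
  exact_mod_cast h1.trans (hN.encard_le x)

/-- A triangulation with bounded degrees is locally finite. -/
@[reducible]
noncomputable def IsMaxDegree.locallyFiniteGraph (hN : T.IsMaxDegree N) :
    T.graph.LocallyFinite := fun v =>
  (Set.finite_of_encard_le_coe (hN.encard_le v)).fintype

lemma IsMaxDegree.card_neighborFinset_le [T.graph.LocallyFinite] (hN : T.IsMaxDegree N)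
    (v : T.Vertex) : (T.graph.neighborFinset v).card ≤ N := by
  have := hN.encard_le v
  rw [← SimpleGraph.coe_neighborFinset, Set.encard_coe_eq_coe_finsetCard] at this
  exact_mod_cast this

end PeriodicTriangulation

/-! ### Product measures -/

instance : MeasurableSingletonClass ℤˣ :=
  ⟨fun u => ⟨{(u : ℤ)}, measurableSet_singleton _, by ext x; simp [Units.ext_iff]⟩⟩

section ProductMeasure

variable {ι : Type*} {X : ι → Type*} [∀ i, MeasurableSpace (X i)]

/-- A measurable function that depends only on the coordinates in `A` is measurable with respect
to the σ-algebra generated by these coordinates. -/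
lemma Measurable.comap_le_of_dependsOn {α : Type*} [MeasurableSpace α] {f : (∀ i, X i) → α}
    {A : Set ι} (hf : Measurable f) (hA : DependsOn f A) :
    MeasurableSpace.comap f inferInstance ≤
      ⨆ i ∈ A, MeasurableSpace.comap (fun x : ∀ i, X i => x i) inferInstance := by
  classical
  rcases isEmpty_or_nonempty (∀ i, X i) with h | ⟨⟨x₀⟩⟩
  · intro s _
    rw [Set.eq_empty_of_isEmpty s]
    exact @MeasurableSet.empty _ (_)
  -- Freezing the coordinates outside `A` at those of `x₀` leaves `f` unchanged, and the freezing
  -- map is measurable for the smaller σ-algebra.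
  · have hfact : f = fun x => f (fun i => if i ∈ A then x i else x₀ i) := by
      funext x
      exact hA fun i hi => by simp [hi]
    have hg : Measurable[⨆ i ∈ A, MeasurableSpace.comap (fun x : ∀ i, X i => x i) inferInstance,
        MeasurableSpace.pi] (fun (x : ∀ i, X i) i => if i ∈ A then x i else x₀ i) := by
      refine @measurable_pi_lambda _ _ _ (_) _ _ fun i => ?_
      by_cases hi : i ∈ A
      · simp only [hi, if_true]
        rw [measurable_iff_comap_le]
        exact le_iSup₂_of_le (f := fun i (_ : i ∈ A) =>
          MeasurableSpace.comap (fun x : ∀ i, X i => x i) inferInstance) i hi le_rfl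
      · simp only [hi, if_false]
        exact measurable_const
    rw [hfact]
    exact (hf.comp hg).comap_le

variable (P : ∀ i, Measure (X i)) [∀ i, IsProbabilityMeasure (P i)]

/-- Functions of disjoint sets of coordinates are independent under a product measure. -/
lemma indepFun_infinitePi_of_dependsOn {α β : Type*} [MeasurableSpace α] [MeasurableSpace β]
    {f : (∀ i, X i) → α} {g : (∀ i, X i) → β} {A B : Set ι} (hf : Measurable f)
    (hg : Measurable g) (hA : DependsOn f A) (hB : DependsOn g B) (hAB : Disjoint A B) :
    IndepFun f g (Measure.infinitePi P) := by
  have hi : iIndepFun (fun i (x : ∀ i, X i) => x i) (Measure.infinitePi P) :=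
    iIndepFun_infinitePi (X := fun _ x => x) fun _ => measurable_id
  have := indep_iSup_of_disjoint (fun i => (measurable_pi_apply i).comap_le) hi.iIndep hAB
  exact indep_of_indep_of_le_left (indep_of_indep_of_le_right this
    (hg.comap_le_of_dependsOn hB)) (hf.comap_le_of_dependsOn hA)

/-- Events on disjoint sets of coordinates are independent under a product measure. -/
lemma infinitePi_inter_of_dependsOn {E F : Set (∀ i, X i)} {A B : Set ι}
    (hE : MeasurableSet E) (hF : MeasurableSet F) (hA : DependsOn (fun x => x ∈ E) A)
    (hB : DependsOn (fun x => x ∈ F) B) (hAB : Disjoint A B) :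
    Measure.infinitePi P (E ∩ F) = Measure.infinitePi P E * Measure.infinitePi P F := by
  have := (indepFun_infinitePi_of_dependsOn P (measurable_mem.2 hE) (measurable_mem.2 hF)
    hA hB hAB).measure_inter_preimage_eq_mul {True} {True} trivial trivial
  have h : ∀ S : Set (∀ i, X i), (fun x => x ∈ S) ⁻¹' {True} = S := fun S => by ext; simp
  rwa [h, h] at this

end ProductMeasure

/-- Probability measures on `{-1, 1}^V` that agree on cylinders are equal. -/
lemma measure_ext_of_cylinders {V : Type*} {μ ν : Measure (V → ℤˣ)}
    [IsFiniteMeasure μ] [IsFiniteMeasure ν]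
    (h : ∀ (W : Finset V) (τ : V → ℤˣ),
      μ {y | ∀ w ∈ W, y w = τ w} = ν {y | ∀ w ∈ W, y w = τ w}) : μ = ν := by
  classical
  have hproj : ∀ W : Finset V, μ.map W.restrict = ν.map W.restrict := by
    intro W
    refine Measure.ext_of_singleton fun τ => ?_
    rw [Measure.map_apply (Finset.measurable_restrict W) (measurableSet_singleton _),
      Measure.map_apply (Finset.measurable_restrict W) (measurableSet_singleton _)]
    have : (W.restrict (π := fun _ => ℤˣ)) ⁻¹' {τ} =
        {y : V → ℤˣ | ∀ w ∈ W, y w = (fun v => if h : v ∈ W then τ ⟨v, h⟩ else 1) w} := by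
      ext y
      simp only [Set.mem_preimage, Set.mem_singleton_iff, Set.mem_ofPred_eq, funext_iff,
        Finset.restrict, Subtype.forall]
      exact forall₂_congr fun w hw => by simp [hw]
    rw [this, h]
  have : ∀ W : Finset V, IsFiniteMeasure (μ.map W.restrict) := fun W => inferInstance
  exact IsProjectiveLimit.unique (P := fun W => μ.map W.restrict) (fun W => rfl)
    (fun W => (hproj W).symm)

/-! ### Heat bath updates -/

/-- The randomness of an update: a fair sign and a uniform variable. -/
abbrev SiteNoise : Type := ℤˣ × unitInterval

/-- The law of a fair sign. -/
noncomputable def coinLaw : Measure ℤˣ :=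
  (2⁻¹ : ENNReal) • (Measure.dirac 1 + Measure.dirac (-1))

instance : IsProbabilityMeasure coinLaw :=
  ⟨by simp [coinLaw, ENNReal.inv_two_add_inv_two]⟩

/-- The law of the randomness of an update. -/
noncomputable def siteLaw : Measure SiteNoise := coinLaw.prod volume

instance : IsProbabilityMeasure siteLaw := by unfold siteLaw; infer_instance

lemma coinLaw_map_neg : coinLaw.map (fun u => -u) = coinLaw := by
  simp [coinLaw, Measure.map_smul, Measure.map_add, measurable_of_countable,
    add_comm]

lemma coinLaw_singleton (u : ℤˣ) : coinLaw {u} = 2⁻¹ := by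
  rcases Int.units_eq_one_or u with rfl | rfl <;>
    simp [coinLaw, Set.indicator, Units.ext_iff]

/-- Change of the sign in the randomness of an update. -/
def SiteNoise.flip (u : SiteNoise) : SiteNoise := (-u.1, u.2)

lemma SiteNoise.measurable_flip : Measurable SiteNoise.flip :=
  ((measurable_of_countable (fun u : ℤˣ => -u)).comp measurable_fst).prodMk measurable_snd

lemma siteLaw_map_flip : siteLaw.map SiteNoise.flip = siteLaw := by
  have h := Measure.map_prod_map coinLaw (volume : Measure unitInterval)
    (measurable_of_countable (fun u : ℤˣ => -u)) measurable_id
  rw [coinLaw_map_neg, Measure.map_id] at h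
  exact h.symm

lemma siteLaw_fst (u : ℤˣ) : siteLaw {x | x.1 = u} = 2⁻¹ := by
  have : {x : SiteNoise | x.1 = u} = {u} ×ˢ Set.univ := by ext; simp
  rw [this, siteLaw, Measure.prod_prod, coinLaw_singleton]
  simp

lemma siteLaw_snd_lt {p : ℝ} (h0 : 0 ≤ p) (h1 : p ≤ 1) :
    siteLaw {x | (x.2 : ℝ) < p} = ENNReal.ofReal p := by
  have : {x : SiteNoise | (x.2 : ℝ) < p} = Set.univ ×ˢ Set.Iio ⟨p, h0, h1⟩ := by
    ext x; simp [← Subtype.coe_lt_coe]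
  rw [this, siteLaw, Measure.prod_prod, unitInterval.volume_Iio]
  simp

/-- Sampling of a spin in the local field `h`: the sign of `h` if `u.2 < |tanh h|`, and a fair
sign otherwise. -/
noncomputable def heatBath (h : ℝ) (u : SiteNoise) : ℤˣ :=
  if (u.2 : ℝ) < |Real.tanh h| then (if 0 < h then 1 else -1) else u.1

/-- The arbitrary sign given to the field `0` does no harm: the threshold is then `0`, the strict
inequality never holds, and the coin decides. -/
lemma heatBath_neg (h : ℝ) (u : SiteNoise) : heatBath (-h) u.flip = -heatBath h u := by
  unfold heatBath SiteNoise.flip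
  rw [Real.tanh_neg, abs_neg]
  rcases lt_trichotomy h 0 with hh | rfl | hh
  · simp [hh, not_lt.2 hh.le]; split_ifs <;> rfl
  · simp [not_lt.2 u.2.2.1]
  · simp [hh, not_lt.2 hh.le]; split_ifs <;> rfl

lemma Real.measurable_tanh : Measurable Real.tanh := by
  have : Real.tanh = fun x => Real.sinh x / Real.cosh x := funext Real.tanh_eq_sinh_div_cosh
  rw [this]
  fun_prop

lemma Real.tanh_mono : Monotone Real.tanh := by
  intro x y hxy
  rw [Real.tanh_eq_sinh_div_cosh, Real.tanh_eq_sinh_div_cosh,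
    div_le_div_iff₀ (Real.cosh_pos x) (Real.cosh_pos y)]
  have := Real.sinh_nonneg_iff.2 (sub_nonneg.2 hxy)
  rw [Real.sinh_sub] at this
  linarith

lemma Real.abs_tanh (x : ℝ) : |Real.tanh x| = Real.tanh |x| := by
  have h0 : ∀ y : ℝ, 0 ≤ y → 0 ≤ Real.tanh y := fun y hy => by
    simpa using Real.tanh_mono hy
  rcases le_total 0 x with h | h
  · rw [abs_of_nonneg h, abs_of_nonneg (h0 x h)]
  · rw [abs_of_nonpos h, Real.tanh_neg, abs_of_nonpos]
    have := h0 (-x) (by linarith)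
    rw [Real.tanh_neg] at this
    linarith

lemma measurable_heatBath : Measurable (fun x : ℝ × SiteNoise => heatBath x.1 x.2) := by
  unfold heatBath
  have ht := Real.measurable_tanh
  have h : Measurable fun x : ℝ × SiteNoise => |Real.tanh x.1| :=
    (ht.comp measurable_fst).abs
  exact Measurable.ite (measurableSet_lt (by fun_prop) h)
    (Measurable.ite (measurableSet_lt measurable_const measurable_fst) measurable_const
      measurable_const) (by fun_prop)

lemma measurableSet_heatBath_eq (h : ℝ) (τ : ℤˣ) : MeasurableSet {u | heatBath h u = τ} :=
  (measurable_heatBath.comp (measurable_const.prodMk measurable_id)) (measurableSet_singleton τ)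

lemma siteLaw_heatBath_neg (h : ℝ) (τ : ℤˣ) :
    siteLaw {u | heatBath (-h) u = -τ} = siteLaw {u | heatBath h u = τ} := by
  conv_lhs => rw [← siteLaw_map_flip,
    Measure.map_apply SiteNoise.measurable_flip (measurableSet_heatBath_eq _ _)]
  simp only [Set.preimage_ofPred_eq, heatBath_neg, neg_inj]

/-- Against a nonnegative field, the spin `-1` arises only when the uniform variable reaches the
threshold and the coin shows `-1`, two independent events. -/
lemma siteLaw_heatBath_of_nonneg {h : ℝ} (hh : 0 ≤ h) :
    siteLaw {u | heatBath h u = -1} = ENNReal.ofReal ((1 - Real.tanh h) / 2) := by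
  have h0 : 0 ≤ Real.tanh h := by simpa using Real.tanh_mono hh
  have h1 : Real.tanh h < 1 := Real.tanh_lt_one h
  have : {u : SiteNoise | heatBath h u = -1} = {-1} ×ˢ Set.Ici ⟨Real.tanh h, h0, h1.le⟩ := by
    ext u
    simp only [heatBath, abs_of_nonneg h0, Set.mem_ofPred_eq, Set.mem_prod,
      Set.mem_singleton_iff, Set.mem_Ici, ← Subtype.coe_le_coe]
    split_ifs with h2 h3
    · simp [not_le.2 h2]
    · obtain rfl : h = 0 := le_antisymm (not_lt.1 h3) hh
      simp [not_lt.2 u.2.2.1] at h2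
    · simp [not_lt.1 h2]
  rw [this, siteLaw, Measure.prod_prod, coinLaw_singleton, unitInterval.volume_Ici,
    div_eq_inv_mul, ENNReal.ofReal_mul (by norm_num), ENNReal.ofReal_inv_of_pos (by norm_num)]
  simp

lemma siteLaw_heatBath_eq_tanh (h : ℝ) (τ : ℤˣ) :
    siteLaw {u | heatBath h u = τ} = ENNReal.ofReal ((1 + ((τ : ℤ) : ℝ) * Real.tanh h) / 2) := by
  wlog hh : 0 ≤ h generalizing h τ
  · rw [← siteLaw_heatBath_neg, this (-h) (-τ) (by linarith), Real.tanh_neg]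
    simp
  rcases Int.units_eq_one_or τ with rfl | rfl
  · have hc : {u : SiteNoise | heatBath h u = 1} = {u | heatBath h u = -1}ᶜ := by
      ext u
      have : (1 : ℤˣ) ≠ -1 := by decide
      rcases Int.units_eq_one_or (heatBath h u) with h | h <;> simp [h, this, this.symm]
    have h1 : Real.tanh h < 1 := Real.tanh_lt_one h
    rw [hc, prob_compl_eq_one_sub (measurableSet_heatBath_eq _ _), siteLaw_heatBath_of_nonneg hh,
      ← ENNReal.ofReal_one, ← ENNReal.ofReal_sub _ (by linarith)]
    congr 1
    simp; ring
  · rw [siteLaw_heatBath_of_nonneg hh]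
    congr 2
    simp; ring

/-- The heat bath update samples a spin from its conditional law given the local field. -/
lemma siteLaw_heatBath (h : ℝ) (τ : ℤˣ) :
    siteLaw {u | heatBath h u = τ} =
      ENNReal.ofReal (Real.exp (((τ : ℤ) : ℝ) * h) / (Real.exp h + Real.exp (-h))) := by
  rw [siteLaw_heatBath_eq_tanh, Real.tanh_eq]
  congr 1
  have : 0 < Real.exp h + Real.exp (-h) := by positivity
  rcases Int.units_eq_one_or τ with rfl | rfl <;> · simp; field_simp; ring

/-! ### Glauber dynamics -/

namespace Glauber

variable {V : Type*} (G : SimpleGraph V)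

/-- The vertices at graph distance at most `k` from `v` in the connected component of `v`. -/
def ball (k : ℕ) (v : V) : Set V := {w | ∃ p : G.Walk v w, p.length ≤ k}

lemma self_mem_ball (k : ℕ) (v : V) : v ∈ ball G k v := ⟨.nil, by simp⟩

lemma ball_subset_of_adj {k : ℕ} {v w : V} (h : G.Adj v w) : ball G k w ⊆ ball G (k + 1) v :=
  fun _ ⟨p, hp⟩ => ⟨.cons h p, by simpa using hp⟩

variable [G.LocallyFinite]

/-- The noise of the dynamics: for each time and vertex, one variable for the clocks
(third coordinate `true`) and one for the updates (third coordinate `false`). -/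
abbrev Noise (V : Type*) : Type _ := ℕ × V × Bool → SiteNoise

/-- The law of the noise. -/
noncomputable def noiseLaw (V : Type*) : Measure (Noise V) :=
  Measure.infinitePi fun _ => siteLaw

instance : IsProbabilityMeasure (noiseLaw V) := by unfold noiseLaw; infer_instance

/-- The sum of the spins of the neighbours of `v`. -/
def localField (y : V → ℤˣ) (v : V) : ℝ := ∑ w ∈ G.neighborFinset v, ((y w : ℤ) : ℝ)

/-- The clock of `v` rings at time `t`. -/
def Rings (ω : Noise V) (t : ℕ) (v : V) : Prop := (ω (t, v, true)).1 = 1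

/-- The vertex `v` is updated at time `t`: its clock rings, but not those of its neighbours. -/
def Active (ω : Noise V) (t : ℕ) (v : V) : Prop :=
  Rings ω t v ∧ ∀ w ∈ G.neighborFinset v, ¬ Rings ω t w

open Classical in
/-- The configuration at time `t`, when the previous one is `x` and the updates look at the
configuration `y`. -/
noncomputable def step (β : ℝ) (ω : Noise V) (t : ℕ) (x y : V → ℤˣ) (v : V) : ℤˣ :=
  if Active G ω t v then heatBath (β * localField G y v) (ω (t, v, false)) else x v

/-- The Glauber dynamics started from `x`. -/
noncomputable def run (β : ℝ) (x : V → ℤˣ) : ℕ → Noise V → V → ℤˣ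
  | 0, _ => x
  | t + 1, ω => step G β ω (t + 1) (run β x t ω) (run β x t ω)

/-- The Glauber dynamics started from fair coins, where the updates are traced back for at most
`k` generations and their input is then replaced by the initial coins. -/
noncomputable def factor (β : ℝ) : ℕ → ℕ → Noise V → V → ℤˣ
  | 0, _, ω => fun v => (ω (0, v, false)).1
  | _ + 1, 0, ω => fun v => (ω (0, v, false)).1
  -- A spin that is not updated keeps its budget `k + 1`; only looking at the neighbours costs a
  -- generation. The range is thus bounded by `k`, uniformly in `t`.
  | k + 1, t + 1, ω => step G β ω (t + 1) (factor β (k + 1) t ω) (factor β k t ω)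

lemma factor_time_zero (β : ℝ) (k : ℕ) (ω : Noise V) :
    factor G β k 0 ω = fun v => (ω (0, v, false)).1 := by
  cases k <;> simp [factor]

/-! #### Measurability -/

lemma measurable_localField (v : V) : Measurable fun y : V → ℤˣ => localField G y v := by
  unfold localField
  refine Finset.measurable_fun_sum _ fun w _ => ?_
  exact (measurable_of_countable fun u : ℤˣ => ((u : ℤ) : ℝ)).comp (measurable_pi_apply w)

lemma measurableSet_rings (t : ℕ) (v : V) : MeasurableSet {ω : Noise V | Rings ω t v} :=
  (measurable_fst.comp (measurable_pi_apply (t, v, true))) (measurableSet_singleton 1)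

lemma measurableSet_active (t : ℕ) (v : V) : MeasurableSet {ω : Noise V | Active G ω t v} := by
  have : {ω : Noise V | Active G ω t v} =
      {ω | Rings ω t v} ∩ ⋂ w ∈ G.neighborFinset v, {ω | Rings ω t w}ᶜ := by
    ext ω; simp [Active]
  rw [this]
  exact (measurableSet_rings t v).inter
    (Finset.measurableSet_biInter _ fun w _ => (measurableSet_rings t w).compl)

lemma measurable_step (β : ℝ) (t : ℕ) :
    Measurable fun p : Noise V × (V → ℤˣ) × (V → ℤˣ) => step G β p.1 t p.2.1 p.2.2 := by
  refine measurable_pi_lambda _ fun v => ?_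
  refine Measurable.ite (measurable_fst (measurableSet_active G t v)) ?_ ?_
  · refine measurable_heatBath.comp (Measurable.prodMk ?_ ?_)
    · exact ((measurable_localField G v).comp
        (measurable_snd.comp measurable_snd)).const_mul β
    · exact (measurable_pi_apply (t, v, false)).comp measurable_fst
  · exact (measurable_pi_apply v).comp (measurable_fst.comp measurable_snd)

lemma measurable_factor (β : ℝ) (k t : ℕ) : Measurable (factor G β k t) := by
  have h0 : Measurable fun (ω : Noise V) (v : V) => (ω (0, v, false)).1 :=
    measurable_pi_lambda _ fun v => measurable_fst.comp (measurable_pi_apply _)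
  induction t generalizing k with
  | zero => rw [show factor G β k 0 = _ from funext fun ω => factor_time_zero G β k ω]; exact h0
  | succ t ih =>
    cases k with
    | zero => exact h0
    | succ k =>
      exact (measurable_step G β (t + 1)).comp
        (measurable_id.prodMk ((ih (k + 1)).prodMk (ih k)) :
          Measurable fun ω => (ω, factor G β (k + 1) t ω, factor G β k t ω))

lemma measurable_run (β : ℝ) (t : ℕ) :
    Measurable fun p : (V → ℤˣ) × Noise V => run G β p.1 t p.2 := by
  induction t with
  | zero => exact measurable_fst
  | succ t ih =>
    exact (measurable_step G β (t + 1)).comp (measurable_snd.prodMk (ih.prodMk ih) :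
      Measurable fun p : (V → ℤˣ) × Noise V => (p.2, run G β p.1 t p.2, run G β p.1 t p.2))

/-! #### Dependence on the noise -/

lemma active_congr {ω ω' : Noise V} {t : ℕ} {v : V}
    (h : ∀ w, w = v ∨ G.Adj v w → ω (t, w, true) = ω' (t, w, true)) :
    Active G ω t v ↔ Active G ω' t v := by
  unfold Active Rings
  rw [h v (Or.inl rfl)]
  refine and_congr_right fun _ => forall₂_congr fun w hw => ?_
  rw [h w (Or.inr (by simpa using hw))]

lemma localField_congr {y y' : V → ℤˣ} {v : V} (h : ∀ w, G.Adj v w → y w = y' w) :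
    localField G y v = localField G y' v :=
  Finset.sum_congr rfl fun w hw => by rw [h w (by simpa using hw)]

lemma step_congr {β : ℝ} {ω ω' : Noise V} {t : ℕ} {x x' y y' : V → ℤˣ} {v : V}
    (hω : ∀ w, w = v ∨ G.Adj v w → ∀ b, ω (t, w, b) = ω' (t, w, b))
    (hx : x v = x' v) (hy : ∀ w, G.Adj v w → y w = y' w) :
    step G β ω t x y v = step G β ω' t x' y' v := by
  unfold step
  rw [hω v (Or.inl rfl), hx, localField_congr G hy]
  classical exact if_congr (active_congr G fun w hw => hω w hw true) rfl rfl

/-- Makes the noise at time `t + 1` independent of everything that happened up to time `t`. -/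
lemma dependsOn_factor_past (β : ℝ) (k t : ℕ) :
    DependsOn (factor G β k t) {i | i.1 ≤ t} := by
  induction t generalizing k with
  | zero =>
    intro ω ω' h
    simp only [factor_time_zero]
    exact funext fun v => by rw [h (0, v, false) (le_refl 0)]
  | succ t ih =>
    cases k with
    | zero =>
      intro ω ω' h
      exact funext fun v => by simp only [factor]; rw [h (0, v, false) (Nat.zero_le _)]
    | succ k =>
      intro ω ω' h
      have hp : ∀ j, factor G β j t ω = factor G β j t ω' := fun j =>
        ih j fun i hi => h i (Nat.le_succ_of_le hi)
      refine funext fun v => ?_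
      simp only [factor, hp]
      exact step_congr G (fun w _ b => h (t + 1, w, b) (le_refl (t + 1))) rfl fun _ _ => rfl

lemma dependsOn_run_past (β : ℝ) (x : V → ℤˣ) (t : ℕ) :
    DependsOn (run G β x t) {i | i.1 ≤ t} := by
  induction t with
  | zero => intro ω ω' _; rfl
  | succ t ih =>
    intro ω ω' h
    have hp : run G β x t ω = run G β x t ω' := ih fun i hi => h i (Nat.le_succ_of_le hi)
    refine funext fun v => ?_
    simp only [run, hp]
    exact step_congr G (fun w _ b => h (t + 1, w, b) (le_refl (t + 1))) rfl fun _ _ => rfl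

/-- Each generation moves by one edge. The neighbouring clocks consulted by an update lie at
distance `1`, hence in the ball because the budget is then positive. -/
lemma dependsOn_factor_ball (β : ℝ) (k t : ℕ) (v : V) :
    DependsOn (fun ω => factor G β k t ω v) {i | i.2.1 ∈ ball G k v} := by
  induction t generalizing k v with
  | zero =>
    intro ω ω' h
    simp only [factor_time_zero]
    rw [h (0, v, false) (self_mem_ball G k v)]
  | succ t ih =>
    cases k with
    | zero =>
      intro ω ω' h
      simp only [factor]
      rw [h (0, v, false) (self_mem_ball G 0 v)]
    | succ k =>
      intro ω ω' h
      refine step_congr G (fun w hw b => h (t + 1, w, b) ?_) (ih (k + 1) v h) fun w hw => ?_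
      · rcases hw with rfl | hw
        · exact self_mem_ball G _ _
        · exact ball_subset_of_adj G hw (self_mem_ball G k w)
      · exact ih k w fun i hi => h i (ball_subset_of_adj G hw hi)

/-- The truncated dynamics is a finite-range factor of the noise, hence is finitely dependent. -/
lemma indepFun_factor (β : ℝ) (k t : ℕ) {A B : Set V}
    (h : ∀ a ∈ A, ∀ b ∈ B, 2 * k < G.dist a b) :
    IndepFun (A.domRestrict : (V → ℤˣ) → A → ℤˣ) (B.domRestrict : (V → ℤˣ) → B → ℤˣ)
      ((noiseLaw V).map (factor G β k t)) := by
  have hm : ∀ S : Set V, Measurable (S.domRestrict : (V → ℤˣ) → S → ℤˣ) := fun S =>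
    measurable_pi_lambda _ fun v => measurable_pi_apply _
  have hdep : ∀ S : Set V, DependsOn
      ((S.domRestrict : (V → ℤˣ) → S → ℤˣ) ∘ factor G β k t)
      {i | ∃ v ∈ S, i.2.1 ∈ ball G k v} := fun S ω ω' h => funext fun v =>
    dependsOn_factor_ball G β k t v fun i hi => h i ⟨v, v.2, hi⟩
  have := indepFun_infinitePi_of_dependsOn (fun _ => siteLaw)
    ((hm A).comp (measurable_factor G β k t)) ((hm B).comp (measurable_factor G β k t))
    (hdep A) (hdep B) (Set.disjoint_left.2 ?_)
  · rw [indepFun_iff_measure_inter_preimage_eq_mul] at this ⊢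
    intro s s' hs hs'
    have := this s s' hs hs'
    rwa [Set.preimage_comp, Set.preimage_comp, ← Set.preimage_inter,
      ← Measure.map_apply (measurable_factor G β k t) (hm A hs),
      ← Measure.map_apply (measurable_factor G β k t) (hm B hs'),
      ← Measure.map_apply (measurable_factor G β k t) ((hm A hs).inter (hm B hs'))] at this
  -- A vertex whose noise is used on both sides would give a walk of length at most `2k` from `A` to
  -- `B`.
  · rintro i ⟨a, ha, p, hp⟩ ⟨b, hb, q, hq⟩
    have h1 := h a ha b hb
    have h2 := SimpleGraph.dist_le (p.append q.reverse)
    rw [SimpleGraph.Walk.length_append, SimpleGraph.Walk.length_reverse] at h2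
    omega

/-! #### Symmetries -/

lemma localField_neg (y : V → ℤˣ) (v : V) : localField G (-y) v = -localField G y v := by
  simp [localField]

lemma localField_comp (φ : G ≃g G) (y : V → ℤˣ) (v : V) :
    localField G (fun w => y (φ w)) v = localField G y (φ v) :=
  Finset.sum_equiv φ.toEquiv (fun w => by simp [φ.map_adj_iff]) fun w _ => rfl

/-- Change of the signs of the noise of the updates. -/
def flipNoise (ω : Noise V) : Noise V := fun i => if i.2.2 then ω i else (ω i).flip

lemma noiseLaw_map_flipNoise : (noiseLaw V).map flipNoise = noiseLaw V := by
  have hm : ∀ i : ℕ × V × Bool,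
      Measurable (fun u : SiteNoise => if i.2.2 then u else u.flip) := fun i => by
    split_ifs
    exacts [measurable_id, SiteNoise.measurable_flip]
  refine (Measure.infinitePi_map_pi (fun _ : ℕ × V × Bool => siteLaw) hm).trans ?_
  unfold noiseLaw
  congr 1
  funext i
  by_cases h : i.2.2
  · simp [h]
  · simpa [h] using siteLaw_map_flip

lemma measurable_flipNoise : Measurable (flipNoise : Noise V → Noise V) := by
  refine measurable_pi_lambda _ fun i => ?_
  unfold flipNoise
  split_ifs
  exacts [measurable_pi_apply i, SiteNoise.measurable_flip.comp (measurable_pi_apply i)]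

/-- The clocks are not flipped, so the same vertices are updated, and the local field is odd in the
configuration. -/
lemma step_flipNoise (β : ℝ) (ω : Noise V) (t : ℕ) (x y : V → ℤˣ) :
    step G β (flipNoise ω) t (-x) (-y) = -step G β ω t x y := by
  funext v
  have : Active G (flipNoise ω) t v ↔ Active G ω t v := by simp [Active, Rings, flipNoise]
  by_cases h : Active G ω t v
  · simpa [step, this, h, localField_neg, flipNoise] using heatBath_neg _ _
  · simp [step, this, h]

lemma factor_flipNoise (β : ℝ) (k t : ℕ) (ω : Noise V) :
    factor G β k t (flipNoise ω) = -factor G β k t ω := by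
  induction t generalizing k with
  | zero => simp only [factor_time_zero]; rfl
  | succ t ih =>
    cases k with
    | zero => rfl
    | succ k => simp only [factor, ih, step_flipNoise]

lemma factor_map_neg (β : ℝ) (k t : ℕ) :
    ((noiseLaw V).map (factor G β k t)).map (fun y => -y) =
      (noiseLaw V).map (factor G β k t) := by
  have hn : Measurable fun y : V → ℤˣ => -y :=
    measurable_pi_lambda _ fun v => (measurable_of_countable fun u : ℤˣ => -u).comp
      (measurable_pi_apply v)
  conv_rhs => rw [← noiseLaw_map_flipNoise,
    Measure.map_map (measurable_factor G β k t) measurable_flipNoise]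
  rw [Measure.map_map hn (measurable_factor G β k t)]
  exact congrArg (fun f => (noiseLaw V).map f) (funext fun ω => (factor_flipNoise G β k t ω).symm)

/-- The action of a graph automorphism on the noise. -/
def moveNoise (φ : V → V) (ω : Noise V) : Noise V := fun i => ω (i.1, φ i.2.1, i.2.2)

/-- An injective relabelling of i.i.d. variables gives i.i.d. variables with the same law. -/
lemma noiseLaw_map_moveNoise {φ : V → V} (hφ : φ.Injective) :
    (noiseLaw V).map (moveNoise φ) = noiseLaw V :=
  Measure.map_infinitePi_infinitePi_of_inj (P := fun _ : ℕ × V × Bool => siteLaw)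
    (f := fun i : ℕ × V × Bool => (i.1, φ i.2.1, i.2.2)) fun i j h => by
      simp only [Prod.mk.injEq] at h
      exact Prod.ext h.1 (Prod.ext (hφ h.2.1) h.2.2)

lemma step_moveNoise (β : ℝ) (φ : G ≃g G) (ω : Noise V) (t : ℕ) (x y : V → ℤˣ) :
    step G β (moveNoise φ ω) t (fun v => x (φ v)) (fun v => y (φ v)) =
      fun v => step G β ω t x y (φ v) := by
  funext v
  have : Active G (moveNoise φ ω) t v ↔ Active G ω t (φ v) := by
    unfold Active Rings moveNoise
    refine and_congr_right fun _ => ⟨fun h w hw => ?_, fun h w hw => ?_⟩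
    · have := h (φ.symm w) (by
        rw [SimpleGraph.mem_neighborFinset] at hw ⊢
        rw [← φ.map_adj_iff]; simpa using hw)
      simpa using this
    · exact h (φ w) (by
        rw [SimpleGraph.mem_neighborFinset] at hw ⊢
        exact φ.map_adj_iff.2 hw)
  simp only [step, localField_comp]
  classical exact if_congr this rfl rfl

lemma factor_moveNoise (β : ℝ) (φ : G ≃g G) (k t : ℕ) (ω : Noise V) :
    factor G β k t (moveNoise φ ω) = fun v => factor G β k t ω (φ v) := by
  induction t generalizing k with
  | zero => simp only [factor_time_zero]; rfl
  | succ t ih =>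
    cases k with
    | zero => rfl
    | succ k => simp only [factor, ih, step_moveNoise]

lemma factor_map_comp (β : ℝ) (φ : G ≃g G) (k t : ℕ) :
    ((noiseLaw V).map (factor G β k t)).map (fun y v => y (φ v)) =
      (noiseLaw V).map (factor G β k t) := by
  have hn : Measurable fun (y : V → ℤˣ) (v : V) => y (φ v) :=
    measurable_pi_lambda _ fun v => measurable_pi_apply _
  have hm : Measurable (moveNoise φ : Noise V → Noise V) :=
    measurable_pi_lambda _ fun i => measurable_pi_apply _
  conv_rhs => rw [← noiseLaw_map_moveNoise φ.injective,
    Measure.map_map (measurable_factor G β k t) hm]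
  rw [Measure.map_map hn (measurable_factor G β k t)]
  exact congrArg (fun f => (noiseLaw V).map f)
    (funext fun ω => (factor_moveNoise G β φ k t ω).symm)

end Glauber

namespace Glauber

variable {V : Type*} (G : SimpleGraph V) [G.LocallyFinite]

/-! #### Contraction -/

lemma abs_localField_le (y : V → ℤˣ) (v : V) :
    |localField G y v| ≤ (G.neighborFinset v).card := by
  unfold localField
  refine (Finset.abs_sum_le_sum_abs _ _).trans ?_
  refine (Finset.sum_le_sum (g := fun _ => (1 : ℝ)) fun w _ => ?_).trans (by simp)
  rcases Int.units_eq_one_or (y w) with h | h <;> simp [h]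

/-- The same noise produces different spins only if it is below `p` and if the configurations
around the vertex are different. -/
lemma exists_ne_of_heatBath_ne {β p : ℝ} {N : ℕ} {v : V} (hdeg : (G.neighborFinset v).card ≤ N)
    (hp : Real.tanh (|β| * N) ≤ p) {y y' : V → ℤˣ} {u : SiteNoise}
    (h : heatBath (β * localField G y v) u ≠ heatBath (β * localField G y' v) u) :
    (u.2 : ℝ) < p ∧ ∃ w ∈ G.neighborFinset v, y w ≠ y' w := by
  constructor
  · by_contra! hu
    -- The local field is at most `N` in absolute value, so above `p` the update is the fair sign,
    -- whatever the neighbours.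
    have key : ∀ z : V → ℤˣ, heatBath (β * localField G z v) u = u.1 := fun z => by
      refine if_neg (not_lt.2 (le_trans ?_ (hp.trans hu)))
      rw [Real.abs_tanh, abs_mul]
      refine Real.tanh_mono (mul_le_mul_of_nonneg_left ?_ (abs_nonneg β))
      exact (abs_localField_le G z v).trans (by exact_mod_cast hdeg)
    exact h (by rw [key, key])
  · by_contra! hy
    exact h (by rw [localField_congr G fun w hw => hy w (by simpa using hw)])

lemma dependsOn_active (t : ℕ) (v : V) :
    DependsOn (fun ω : Noise V => ω ∈ {ω | Active G ω t v}) {i | i.1 = t ∧ i.2.2 = true} :=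
  fun _ _ h => propext (active_congr G fun w _ => h (t, w, true) ⟨rfl, rfl⟩)

/-- Being updated prescribes the values of at most `N + 1` independent fair clocks. -/
lemma le_measure_active {N : ℕ} {v : V} (hdeg : (G.neighborFinset v).card ≤ N) (t : ℕ) :
    (1 / 2 : ℝ) ^ (N + 1) ≤ (noiseLaw V).real {ω | Active G ω t v} := by
  classical
  let e : V ↪ ℕ × V × Bool := ⟨fun w => (t, w, true), fun a b h => by simpa using h⟩
  have hset : {ω : Noise V | Active G ω t v} =
      Set.pi ((insert v (G.neighborFinset v)).map e : Finset _)
        fun i => {x : SiteNoise | x.1 = if i.2.1 = v then 1 else -1} := by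
    ext ω
    have hne : ∀ w ∈ G.neighborFinset v, w ≠ v := fun w hw => by
      rw [SimpleGraph.mem_neighborFinset] at hw; exact hw.ne'
    have hu : ∀ u : ℤˣ, u ≠ 1 ↔ u = -1 := by decide
    have hmap : ∀ Q : ℕ × V × Bool → Prop,
        (∀ i ∈ (insert v (G.neighborFinset v)).map e, Q i) ↔
          Q (t, v, true) ∧ ∀ w ∈ G.neighborFinset v, Q (t, w, true) := fun Q => by
      simp only [Finset.map_insert, Finset.forall_mem_insert, Finset.forall_mem_map]
      exact Iff.rfl
    refine Iff.trans ?_ (hmap _).symm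
    refine and_congr (by simp [Rings]) (forall₂_congr fun w hw => ?_)
    simp only [Set.mem_ofPred_eq, if_neg (hne w hw)]
    exact hu _
  have hm : ∀ u : ℤˣ, MeasurableSet {x : SiteNoise | x.1 = u} := fun u =>
    measurable_fst (measurableSet_singleton u)
  rw [measureReal_def, hset, noiseLaw, Measure.infinitePi_pi _ fun i _ => hm _]
  simp only [siteLaw_fst, Finset.prod_const, Finset.card_map, ENNReal.toReal_pow,
    ENNReal.toReal_inv, ENNReal.toReal_ofNat]
  rw [← one_div]
  refine pow_le_pow_of_le_one (by norm_num) (by norm_num) ?_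
  exact (Finset.card_insert_le _ _).trans (by omega)

lemma noiseLaw_real_inter {E F : Set (Noise V)} {A B : Set (ℕ × V × Bool)}
    (hE : MeasurableSet E) (hF : MeasurableSet F) (hA : DependsOn (fun x => x ∈ E) A)
    (hB : DependsOn (fun x => x ∈ F) B) (hAB : Disjoint A B) :
    (noiseLaw V).real (E ∩ F) = (noiseLaw V).real E * (noiseLaw V).real F := by
  simp only [measureReal_def, noiseLaw,
    infinitePi_inter_of_dependsOn (fun _ => siteLaw) hE hF hA hB hAB, ENNReal.toReal_mul]

lemma measurableSet_factor_ne_run (β : ℝ) (x : V → ℤˣ) (k t : ℕ) (v : V) :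
    MeasurableSet {ω : Noise V | factor G β k t ω v ≠ run G β x t ω v} :=
  (measurableSet_eq_fun ((measurable_pi_apply v).comp (measurable_factor G β k t))
    ((measurable_pi_apply v).comp
      ((measurable_run G β t).comp measurable_prodMk_left))).compl

lemma dependsOn_factor_ne_run (β : ℝ) (x : V → ℤˣ) (k t : ℕ) (v : V) :
    DependsOn (fun ω => ω ∈ {ω : Noise V | factor G β k t ω v ≠ run G β x t ω v})
      {i | i.1 ≤ t} := by
  intro ω ω' h
  simp only [Set.mem_ofPred_eq, dependsOn_factor_past G β k t h, dependsOn_run_past G β x t h]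

/-- If the truncated dynamics and the dynamics disagree, either they disagreed before and there
was no update, or they disagreed at a neighbour and the noise is below `p`. -/
lemma factor_ne_run_subset {β p : ℝ} {N : ℕ} {v : V} (hdeg : (G.neighborFinset v).card ≤ N)
    (hp : Real.tanh (|β| * N) ≤ p) (x : V → ℤˣ) (k t : ℕ) :
    {ω : Noise V | factor G β (k + 1) (t + 1) ω v ≠ run G β x (t + 1) ω v} ⊆
      ({ω | Active G ω (t + 1) v}ᶜ ∩ {ω | factor G β (k + 1) t ω v ≠ run G β x t ω v}) ∪
      ⋃ w ∈ G.neighborFinset v,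
        ({ω | Active G ω (t + 1) v} ∩ {ω | ((ω (t + 1, v, false)).2 : ℝ) < p}) ∩
          {ω | factor G β k t ω w ≠ run G β x t ω w} := by
  intro ω hω
  simp only [Set.mem_ofPred_eq, factor, run, step] at hω
  by_cases ha : Active G ω (t + 1) v
  · right
    simp only [ha, if_true] at hω
    obtain ⟨hu, w, hw, hne⟩ := exists_ne_of_heatBath_ne G hdeg hp hω
    exact Set.mem_biUnion hw ⟨⟨ha, hu⟩, hne⟩
  · left
    simp only [ha, if_false] at hω
    exact ⟨ha, hω⟩

/-- The rate at which the dynamics forgets its initial configuration. -/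
noncomputable def mixingRate (N : ℕ) (p : ℝ) : ℝ := 1 - (1 / 2) ^ (N + 1) * (1 - N * p)

lemma mixingRate_nonneg {N : ℕ} {p : ℝ} (hp : 0 ≤ p) : 0 ≤ mixingRate N p := by
  have h1 : (1 / 2 : ℝ) ^ (N + 1) ≤ 1 := pow_le_one₀ (by norm_num) (by norm_num)
  have h2 : 0 ≤ (1 / 2 : ℝ) ^ (N + 1) := by positivity
  have h3 : 0 ≤ N * p := by positivity
  unfold mixingRate
  nlinarith

lemma mixingRate_lt_one {N : ℕ} {p : ℝ} (hp : N * p < 1) : mixingRate N p < 1 := by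
  have : 0 < (1 / 2 : ℝ) ^ (N + 1) * (1 - N * p) := mul_pos (by positivity) (by linarith)
  unfold mixingRate
  linarith

/-- The truncated dynamics is close to the dynamics, whatever its initial configuration. -/
theorem measure_factor_ne_run_le {β p : ℝ} {N : ℕ} (hdeg : ∀ v, (G.neighborFinset v).card ≤ N)
    (hp0 : 0 ≤ p) (hp1 : p ≤ 1) (hp : Real.tanh (|β| * N) ≤ p) (hq : N * p < 1)
    (x : V → ℤˣ) (k t : ℕ) (v : V) :
    (noiseLaw V).real {ω | factor G β k t ω v ≠ run G β x t ω v} ≤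
      (N * p) ^ k + mixingRate N p ^ t := by
  have hl := mixingRate_nonneg (N := N) hp0
  have hq0 : 0 ≤ N * p := by positivity
  induction t generalizing k v with
  | zero =>
    -- At time `0`, as for `k = 0` below, one of the two powers equals `1` and the bound is trivial.
    refine measureReal_le_one.trans ?_
    have : 0 ≤ (N * p) ^ k := by positivity
    simpa using this
  | succ t ih =>
    cases k with
    | zero =>
      refine measureReal_le_one.trans ?_
      have : 0 ≤ mixingRate N p ^ (t + 1) := by positivity
      simpa using this
    | succ k =>
      have hA := measurableSet_active G (t + 1) v
      have hB : MeasurableSet {ω : Noise V | ((ω (t + 1, v, false)).2 : ℝ) < p} :=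
        measurableSet_lt (measurable_subtype_coe.comp
          (measurable_snd.comp (measurable_pi_apply _))) measurable_const
      have hdA := dependsOn_active G (t + 1) v
      have hdB : DependsOn (fun ω => ω ∈ {ω : Noise V | ((ω (t + 1, v, false)).2 : ℝ) < p})
          {i | i.1 = t + 1 ∧ i.2.2 = false} := fun ω ω' h => by
        simp only [Set.mem_ofPred_eq, h (t + 1, v, false) ⟨rfl, rfl⟩]
      have hdisj : Disjoint {i : ℕ × V × Bool | i.1 = t + 1} {i | i.1 ≤ t} :=
        Set.disjoint_left.2 fun i (h1 : i.1 = t + 1) (h2 : i.1 ≤ t) => by omega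
      have hPB : (noiseLaw V).real {ω : Noise V | ((ω (t + 1, v, false)).2 : ℝ) < p} = p := by
        have hmB : MeasurableSet {x : SiteNoise | (x.2 : ℝ) < p} :=
          measurableSet_lt (measurable_subtype_coe.comp measurable_snd) measurable_const
        have := (measurePreserving_eval_infinitePi (fun _ : ℕ × V × Bool => siteLaw)
          (t + 1, v, false)).measure_preimage hmB.nullMeasurableSet
        rw [siteLaw_snd_lt hp0 hp1] at this
        rw [measureReal_def]
        exact (congrArg ENNReal.toReal this).trans (ENNReal.toReal_ofReal hp0)
      have hAB := noiseLaw_real_inter hA hB hdA hdB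
        (Set.disjoint_left.2 fun i h1 h2 => by simp [h1.2] at h2)
      have hdAB : DependsOn (fun ω => ω ∈ {ω : Noise V | Active G ω (t + 1) v} ∩
          {ω | ((ω (t + 1, v, false)).2 : ℝ) < p}) {i | i.1 = t + 1} := fun ω ω' h => by
        simp only [Set.mem_inter_iff]
        exact congrArg₂ And (hdA fun i hi => h i hi.1) (hdB fun i hi => h i hi.1)
      have hdAc : DependsOn (fun ω => ω ∈ {ω : Noise V | Active G ω (t + 1) v}ᶜ)
          {i | i.1 = t + 1} := fun ω ω' h => congrArg Not (hdA fun i hi => h i hi.1)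
      set r := (noiseLaw V).real {ω | Active G ω (t + 1) v} with hr
      have hr1 : r ≤ 1 := measureReal_le_one
      have hr0 : 0 ≤ r := measureReal_nonneg
      have hrδ : (1 / 2 : ℝ) ^ (N + 1) ≤ r := le_measure_active G (hdeg v) (t + 1)
      have hstep := ih (k + 1) v
      have hsum : ∑ w ∈ G.neighborFinset v, (noiseLaw V).real
          (({ω | Active G ω (t + 1) v} ∩ {ω | ((ω (t + 1, v, false)).2 : ℝ) < p}) ∩
            {ω | factor G β k t ω w ≠ run G β x t ω w}) ≤
          N * (r * p * ((N * p) ^ k + mixingRate N p ^ t)) := by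
        have hb : 0 ≤ r * p * ((N * p) ^ k + mixingRate N p ^ t) := by positivity
        refine (Finset.sum_le_card_nsmul _ _ _ fun w _ => ?_).trans
          ((nsmul_eq_mul _ _).trans_le
            (mul_le_mul_of_nonneg_right (by exact_mod_cast hdeg v) hb))
        rw [noiseLaw_real_inter (hA.inter hB) (measurableSet_factor_ne_run G β x k t w) hdAB
          (dependsOn_factor_ne_run G β x k t w) hdisj, hAB, hPB]
        exact mul_le_mul_of_nonneg_left (ih k w) (by positivity)
      calc (noiseLaw V).real {ω | factor G β (k + 1) (t + 1) ω v ≠ run G β x (t + 1) ω v}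
          ≤ _ := measureReal_mono (factor_ne_run_subset G (hdeg v) hp x k t)
        _ ≤ _ := measureReal_union_le _ _
        -- With `r` the probability of an update: either there is none and the earlier error
        -- persists, or one of at most `N` neighbours is wrong and the uniform variable is below
        -- `p`. Clocks, uniform variable and past are independent.
        _ ≤ (1 - r) * ((N * p) ^ (k + 1) + mixingRate N p ^ t) +
            N * (r * p * ((N * p) ^ k + mixingRate N p ^ t)) := by
          refine add_le_add ?_ ((measureReal_biUnion_finset_le _ _).trans hsum)
          rw [noiseLaw_real_inter hA.compl (measurableSet_factor_ne_run G β x (k + 1) t v) hdAc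
            (dependsOn_factor_ne_run G β x (k + 1) t v) hdisj, probReal_compl_eq_one_sub hA]
          exact mul_le_mul_of_nonneg_left hstep (by linarith)
        -- The powers of `Np` reproduce `(Np)^(k+1)` exactly, as the lost generation supplies the
        -- missing factor; only the time term contracts.
        _ = (N * p) ^ (k + 1) + mixingRate N p ^ t * (1 - r * (1 - N * p)) := by ring
        _ ≤ (N * p) ^ (k + 1) + mixingRate N p ^ t * mixingRate N p := by
          have : (1 / 2 : ℝ) ^ (N + 1) * (1 - N * p) ≤ r * (1 - N * p) :=
            mul_le_mul_of_nonneg_right hrδ (by linarith)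
          refine add_le_add le_rfl (mul_le_mul_of_nonneg_left ?_ (by positivity))
          unfold mixingRate
          linarith
        _ = _ := by rw [pow_succ (mixingRate N p)]

end Glauber

namespace Glauber

variable {V : Type*} (G : SimpleGraph V) [G.LocallyFinite]

/-! #### Invariant measures -/

/-- A measure is invariant under heat bath updates if it does not change when the spins in a finite
independent set `J` are resampled according to their local fields. -/
def HeatBathInvariant (β : ℝ) (μ : Measure (V → ℤˣ)) : Prop :=
  ∀ (W J : Finset V) (τ : V → ℤˣ), J ⊆ W → (∀ a ∈ J, ∀ b ∈ J, ¬ G.Adj a b) →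
    ∫⁻ y in {y | ∀ w ∈ W, w ∉ J → y w = τ w},
      ∏ v ∈ J, siteLaw {u | heatBath (β * localField G y v) u = τ v} ∂μ =
    μ {y | ∀ w ∈ W, y w = τ w}

lemma measurableSet_cylinder (W : Finset V) (τ : V → ℤˣ) (Q : V → Prop) :
    MeasurableSet {y : V → ℤˣ | ∀ w ∈ W, Q w → y w = τ w} := by
  have : {y : V → ℤˣ | ∀ w ∈ W, Q w → y w = τ w} =
      ⋂ w ∈ W, ⋂ _ : Q w, {y | y w = τ w} := by ext; simp
  rw [this]
  exact Finset.measurableSet_biInter _ fun w _ => MeasurableSet.iInter fun _ =>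
    (measurable_pi_apply w) (measurableSet_singleton _)

/-- The event that the clocks in `W` that ring at time `t` are those in `R`. -/
def ringPattern (t : ℕ) (W R : Finset V) : Set (Noise V) := {ω | ∀ w ∈ W, Rings ω t w ↔ w ∈ R}

lemma measurableSet_ringPattern (t : ℕ) (W R : Finset V) :
    MeasurableSet (ringPattern t W R) := by
  have : ringPattern t W R = ⋂ w ∈ W, {ω | Rings ω t w ↔ w ∈ R} := by ext; simp [ringPattern]
  rw [this]
  refine Finset.measurableSet_biInter _ fun w _ => ?_
  by_cases h : w ∈ R
  · simpa [h] using measurableSet_rings t w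
  · have := (measurableSet_rings t w).compl
    rwa [show {ω : Noise V | Rings ω t w ↔ w ∈ R} = {ω | Rings ω t w}ᶜ by ext; simp [h]]

lemma dependsOn_ringPattern (t : ℕ) (W R : Finset V) :
    DependsOn (fun ω : Noise V => ω ∈ ringPattern t W R) {i | i.2.2 = true} := fun ω ω' h => by
  have : ∀ w, Rings ω t w ↔ Rings ω' t w := fun w => by
    unfold Rings; rw [h (t, w, true) rfl]
  simp [ringPattern, this]

/-- Law of total probability: every noise realises exactly one pattern of ringing clocks in `W`. -/
lemma sum_ringPattern_inter (t : ℕ) (W : Finset V) {E : Set (Noise V)} (hE : MeasurableSet E) :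
    ∑ R ∈ W.powerset, noiseLaw V (ringPattern t W R ∩ E) = noiseLaw V E := by
  classical
  rw [← measure_biUnion_finset]
  · congr 1
    ext ω
    simp only [Set.mem_iUnion, Set.mem_inter_iff, exists_prop]
    refine ⟨fun ⟨R, _, _, h⟩ => h, fun h => ⟨W.filter fun w => Rings ω t w, ?_, ?_, h⟩⟩
    · exact Finset.mem_powerset.2 (Finset.filter_subset _ _)
    · intro w hw; simp [hw]
  · intro R hR R' hR' hne
    refine Set.disjoint_left.2 fun ω h h' => hne ?_
    ext w
    have hs := Finset.mem_powerset.1 hR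
    have hs' := Finset.mem_powerset.1 hR'
    exact ⟨fun hw => (h'.1 w (hs hw)).1 ((h.1 w (hs hw)).2 hw),
      fun hw => (h.1 w (hs' hw)).1 ((h'.1 w (hs' hw)).2 hw)⟩
  · exact fun R _ => (measurableSet_ringPattern t W R).inter hE

open Classical in
/-- The vertices of `W` that are updated when the ringing clocks are those in `R`. -/
noncomputable def activeSet (W R : Finset V) : Finset V :=
  W.filter fun v => v ∈ R ∧ ∀ w ∈ G.neighborFinset v, w ∉ R

lemma mem_activeSet {W R : Finset V} {v : V} :
    v ∈ activeSet G W R ↔ v ∈ W ∧ v ∈ R ∧ ∀ w ∈ G.neighborFinset v, w ∉ R := by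
  simp [activeSet]

lemma noiseLaw_heatBath_eq (t : ℕ) (J : Finset V) (h : V → ℝ) (τ : V → ℤˣ) :
    noiseLaw V {ω | ∀ v ∈ J, heatBath (h v) (ω (t, v, false)) = τ v} =
      ∏ v ∈ J, siteLaw {u | heatBath (h v) u = τ v} := by
  let e : V ↪ ℕ × V × Bool := ⟨fun w => (t, w, false), fun a b h => by simpa using h⟩
  have hset : {ω : Noise V | ∀ v ∈ J, heatBath (h v) (ω (t, v, false)) = τ v} =
      Set.pi (J.map e : Finset _) fun i => {u | heatBath (h i.2.1) u = τ i.2.1} := by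
    ext ω
    have hmap : ∀ Q : ℕ × V × Bool → Prop,
        (∀ i ∈ J.map e, Q i) ↔ ∀ w ∈ J, Q (t, w, false) := fun Q => by
      simp only [Finset.forall_mem_map]
      exact Iff.rfl
    exact (hmap fun i => heatBath (h i.2.1) (ω i) = τ i.2.1).symm
  rw [hset, noiseLaw, Measure.infinitePi_pi _ fun i _ => measurableSet_heatBath_eq _ _,
    Finset.prod_map]
  rfl

lemma measurableSet_step_cylinder (β : ℝ) (t : ℕ) (z : V → ℤˣ) (W : Finset V) (τ : V → ℤˣ) :
    MeasurableSet {ω : Noise V | ∀ w ∈ W, step G β ω t z z w = τ w} := by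
  have := ((measurable_step G β t).comp (measurable_prodMk_right (y := (z, z))))
    (measurableSet_cylinder W τ fun _ => True)
  simpa using this

open Classical in
/-- The law of a step of the dynamics in terms of the clocks that ring. -/
lemma noiseLaw_step_cylinder (β : ℝ) (t : ℕ) (z : V → ℤˣ) (W W' : Finset V) (hW : W ⊆ W')
    (hW' : ∀ v ∈ W, G.neighborFinset v ⊆ W') (τ : V → ℤˣ) :
    noiseLaw V {ω | ∀ w ∈ W, step G β ω t z z w = τ w} =
      ∑ R ∈ W'.powerset, noiseLaw V (ringPattern t W' R) *
        Set.indicator {y | ∀ w ∈ W, w ∉ activeSet G W R → y w = τ w}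
          (fun y => ∏ v ∈ activeSet G W R,
            siteLaw {u | heatBath (β * localField G y v) u = τ v}) z := by
  rw [← sum_ringPattern_inter t W' (measurableSet_step_cylinder G β t z W τ)]
  refine Finset.sum_congr rfl fun R _ => ?_
  -- Since `W'` contains `W` and its neighbours, the pattern decides which vertices of `W` are
  -- updated.
  have hact : ∀ ω ∈ ringPattern t W' R, ∀ v ∈ W,
      (Active G ω t v ↔ v ∈ activeSet G W R) := fun ω hω v hv => by
    rw [mem_activeSet, Active, hω v (hW hv), and_iff_right hv]
    exact and_congr_right fun _ => forall₂_congr fun w hw => not_congr (hω w (hW' v hv hw))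
  by_cases hz : ∀ w ∈ W, w ∉ activeSet G W R → z w = τ w
  · rw [Set.indicator_of_mem
      (s := {y : V → ℤˣ | ∀ w ∈ W, w ∉ activeSet G W R → y w = τ w}) hz, ← noiseLaw_heatBath_eq t]
    have hset : ringPattern t W' R ∩ {ω : Noise V | ∀ w ∈ W, step G β ω t z z w = τ w} =
        ringPattern t W' R ∩ {ω | ∀ v ∈ activeSet G W R,
          heatBath (β * localField G z v) (ω (t, v, false)) = τ v} := by
      ext ω
      refine and_congr_right fun hω => ⟨fun h v hv => ?_, fun h w hw => ?_⟩
      · have hvW := ((mem_activeSet G).1 hv).1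
        have := h v hvW
        rwa [step, if_pos ((hact ω hω v hvW).2 hv)] at this
      · by_cases ha : w ∈ activeSet G W R
        · rw [step, if_pos ((hact ω hω w hw).2 ha)]
          exact h w ha
        · rw [step, if_neg (fun h' => ha ((hact ω hω w hw).1 h'))]
          exact hz w hw ha
    rw [hset]
    refine infinitePi_inter_of_dependsOn (fun _ => siteLaw) (measurableSet_ringPattern t W' R) ?_
      (dependsOn_ringPattern t W' R) (B := {i | i.2.2 = false}) ?_ ?_
    · have : {ω : Noise V | ∀ v ∈ activeSet G W R,
          heatBath (β * localField G z v) (ω (t, v, false)) = τ v} =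
          ⋂ v ∈ activeSet G W R, (fun ω => ω (t, v, false)) ⁻¹'
            {u | heatBath (β * localField G z v) u = τ v} := by ext; simp
      rw [this]
      exact Finset.measurableSet_biInter _ fun v _ =>
        (measurable_pi_apply _) (measurableSet_heatBath_eq _ _)
    · intro ω ω' h
      refine propext (forall₂_congr fun v _ => ?_)
      rw [h (t, v, false) rfl]
    · exact Set.disjoint_left.2 fun i (h1 : i.2.2 = true) (h2 : i.2.2 = false) => by
        simp [h1] at h2
  · rw [Set.indicator_of_notMem
      (s := {y : V → ℤˣ | ∀ w ∈ W, w ∉ activeSet G W R → y w = τ w}) hz, mul_zero]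
    refine measure_mono_null (t := ∅) (fun ω hω => hz fun w hw ha => ?_) measure_empty
    have := hω.2 w hw
    rwa [step, if_neg (fun h' => ha ((hact ω hω.1 w hw).1 h'))] at this

variable {G} {β : ℝ} {μ : Measure (V → ℤˣ)} [IsProbabilityMeasure μ]

lemma measurable_siteLaw_heatBath (v : V) (u : ℤˣ) :
    Measurable fun y : V → ℤˣ => siteLaw {x | heatBath (β * localField G y v) x = u} := by
  simp only [siteLaw_heatBath]
  have := measurable_localField G v
  fun_prop

/-- A heat bath invariant measure is invariant under a step of the dynamics. -/
lemma HeatBathInvariant.map_step (hμ : HeatBathInvariant G β μ) (t : ℕ) :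
    (μ.prod (noiseLaw V)).map (fun p => step G β p.2 t p.1 p.1) = μ := by
  classical
  have hm : Measurable fun p : (V → ℤˣ) × Noise V => step G β p.2 t p.1 p.1 :=
    (measurable_step G β t).comp (measurable_snd.prodMk (measurable_fst.prodMk measurable_fst))
  have : IsProbabilityMeasure
      ((μ.prod (noiseLaw V)).map (fun p => step G β p.2 t p.1 p.1)) :=
    Measure.isProbabilityMeasure_map hm.aemeasurable
  refine measure_ext_of_cylinders fun W τ => ?_
  have hC : MeasurableSet {y : V → ℤˣ | ∀ w ∈ W, y w = τ w} := by
    simpa using measurableSet_cylinder W τ fun _ => True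
  rw [Measure.map_apply hm hC, Measure.prod_apply (hm hC)]
  set W' := W ∪ W.biUnion fun v => G.neighborFinset v with hW'
  have hsub : ∀ v ∈ W, G.neighborFinset v ⊆ W' := fun v hv =>
    (Finset.subset_biUnion_of_mem (fun v => G.neighborFinset v) hv).trans
      Finset.subset_union_right
  have heq : ∀ z, noiseLaw V (Prod.mk z ⁻¹' ((fun p : (V → ℤˣ) × Noise V =>
      step G β p.2 t p.1 p.1) ⁻¹' {y | ∀ w ∈ W, y w = τ w})) = _ := fun z =>
    noiseLaw_step_cylinder G β t z W W' Finset.subset_union_left hsub τ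
  have hprod : ∀ J : Finset V, Measurable fun y : V → ℤˣ =>
      ∏ v ∈ J, siteLaw {u | heatBath (β * localField G y v) u = τ v} := fun J =>
    Finset.measurable_fun_prod _ fun v _ => measurable_siteLaw_heatBath v (τ v)
  simp_rw [heq]
  rw [lintegral_finsetSum]
  -- Given the pattern, the updated vertices form an independent set, so invariance applies to each
  -- pattern separately; the probabilities of the patterns sum to `1`.
  · have hterm : ∀ R ∈ W'.powerset, ∫⁻ z, noiseLaw V (ringPattern t W' R) *
        Set.indicator {y | ∀ w ∈ W, w ∉ activeSet G W R → y w = τ w}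
          (fun y => ∏ v ∈ activeSet G W R,
            siteLaw {u | heatBath (β * localField G y v) u = τ v}) z ∂μ =
        noiseLaw V (ringPattern t W' R ∩ Set.univ) * μ {y | ∀ w ∈ W, y w = τ w} := by
      intro R _
      rw [lintegral_const_mul _ ((hprod _).indicator (measurableSet_cylinder W τ _)),
        lintegral_indicator (measurableSet_cylinder W τ _), Set.inter_univ,
        hμ W (activeSet G W R) τ (fun v hv => ((mem_activeSet G).1 hv).1)]
      intro a ha b hb hab
      exact ((mem_activeSet G).1 ha).2.2 b (by simpa using hab) ((mem_activeSet G).1 hb).2.1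
    rw [Finset.sum_congr rfl hterm, ← Finset.sum_mul,
      sum_ringPattern_inter t W' MeasurableSet.univ, measure_univ, one_mul]
  · intro R _
    exact ((hprod _).indicator (measurableSet_cylinder W τ _)).const_mul _

/-- A heat bath invariant measure is invariant under the dynamics. -/
lemma HeatBathInvariant.map_run (hμ : HeatBathInvariant G β μ) (t : ℕ) :
    (μ.prod (noiseLaw V)).map (fun p => run G β p.1 t p.2) = μ := by
  induction t with
  | zero => exact measurePreserving_fst.map_eq
  | succ t ih =>
    have hs : Measurable fun p : (V → ℤˣ) × Noise V => step G β p.2 (t + 1) p.1 p.1 :=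
      (measurable_step G β _).comp (measurable_snd.prodMk (measurable_fst.prodMk measurable_fst))
    have hr := measurable_run G β t
    have hrx : ∀ x, Measurable (run G β x t) := fun x => hr.comp measurable_prodMk_left
    -- The noise at time `t + 1`, copied to all times: it suffices for the next step and is
    -- independent of the past, so it can be replaced by fresh noise.
    let slice : Noise V → Noise V := fun ω i => ω (t + 1, i.2)
    have hsl : Measurable slice := measurable_pi_lambda _ fun i => measurable_pi_apply _
    have hstep : ∀ ω y, step G β ω (t + 1) y y = step G β (slice ω) (t + 1) y y := fun ω y =>
      funext fun v => step_congr G (fun w _ b => rfl) rfl fun _ _ => rfl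
    refine Measure.ext fun A hA => ?_
    conv_rhs => rw [← hμ.map_step (t + 1), Measure.map_apply hs hA, Measure.prod_apply (hs hA),
      ← ih]
    have hg : Measurable fun p : (V → ℤˣ) × Noise V => noiseLaw V (Prod.mk (run G β p.1 t p.2) ⁻¹'
        ((fun p => step G β p.2 (t + 1) p.1 p.1) ⁻¹' A)) :=
      (measurable_measure_prodMk_left (hs hA)).comp hr
    rw [lintegral_map (measurable_measure_prodMk_left (hs hA)) hr,
      lintegral_prod _ hg.aemeasurable,
      Measure.map_apply (measurable_run G β (t + 1)) hA,
      Measure.prod_apply (measurable_run G β (t + 1) hA)]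
    refine lintegral_congr fun x => ?_
    have hind : IndepFun (run G β x t) slice (noiseLaw V) :=
      indepFun_infinitePi_of_dependsOn (fun _ => siteLaw) (hrx x) hsl
        (dependsOn_run_past G β x t) (B := {i | i.1 = t + 1})
        (fun ω ω' h => funext fun i => h (t + 1, i.2) rfl)
        (Set.disjoint_left.2 fun i (h1 : i.1 ≤ t) (h2 : i.1 = t + 1) => by omega)
    have hmap := (indepFun_iff_map_prod_eq_prod_map_map (hrx x).aemeasurable
      hsl.aemeasurable).1 hind
    have hset : Prod.mk x ⁻¹' ((fun p : (V → ℤˣ) × Noise V => run G β p.1 (t + 1) p.2) ⁻¹' A) =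
        (fun ω => (run G β x t ω, slice ω)) ⁻¹'
          ((fun p : (V → ℤˣ) × Noise V => step G β p.2 (t + 1) p.1 p.1) ⁻¹' A) := by
      ext ω
      simp only [Set.mem_preimage, run]
      rw [hstep]
    rw [hset, ← Measure.map_apply ((hrx x).prodMk hsl) (hs hA), hmap,
      Measure.prod_apply (hs hA), lintegral_map (measurable_measure_prodMk_left (hs hA)) (hrx x)]
    refine lintegral_congr fun ω' => ?_
    rw [Measure.map_apply hsl (measurable_prodMk_left (hs hA))]
    rfl

/-- The law of the truncated dynamics is close to a heat bath invariant measure. -/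
theorem HeatBathInvariant.abs_sub_factor_le (hμ : HeatBathInvariant G β μ) {p : ℝ} {N : ℕ}
    (hdeg : ∀ v, (G.neighborFinset v).card ≤ N) (hp0 : 0 ≤ p) (hp1 : p ≤ 1)
    (hp : Real.tanh (|β| * N) ≤ p) (hq : N * p < 1) (k t : ℕ) {W : Finset V}
    {A : Set (V → ℤˣ)} (hA : MeasurableSet A) (hW : DependsOn (fun y => y ∈ A) W) :
    |μ.real A - ((noiseLaw V).map (factor G β k t)).real A| ≤
      W.card * ((N * p) ^ k + mixingRate N p ^ t) := by
  have hr := measurable_run G β t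
  have hf : Measurable fun p : (V → ℤˣ) × Noise V => factor G β k t p.2 :=
    (measurable_factor G β k t).comp measurable_snd
  have h1 : μ.real A =
      (μ.prod (noiseLaw V)).real ((fun p => run G β p.1 t p.2) ⁻¹' A) := by
    rw [← map_measureReal_apply hr hA, hμ.map_run]
  have h2 : ((noiseLaw V).map (factor G β k t)).real A =
      (μ.prod (noiseLaw V)).real ((fun p => factor G β k t p.2) ⁻¹' A) := by
    rw [← map_measureReal_apply hf hA]
    congr 1
    have := Measure.map_map (μ := μ.prod (noiseLaw V)) (measurable_factor G β k t) measurable_snd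
    rwa [measurePreserving_snd.map_eq] at this
  have hD : ∀ w, MeasurableSet
      {p : (V → ℤˣ) × Noise V | factor G β k t p.2 w ≠ run G β p.1 t p.2 w} := fun w =>
    (measurableSet_eq_fun ((measurable_pi_apply w).comp hf)
      ((measurable_pi_apply w).comp hr)).compl
  have hb : 0 ≤ (N * p) ^ k + mixingRate N p ^ t := by
    have := mixingRate_nonneg (N := N) hp0
    positivity
  rw [h1, h2]
  refine (abs_measureReal_sub_le_measureReal_symmDiff (hr hA).nullMeasurableSet
    (hf hA).nullMeasurableSet).trans ?_
  -- Both laws live on one space, with `x` drawn from `μ` and common noise. The events differ only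
  -- if the two processes disagree somewhere in `W`.
  refine (measureReal_mono (s₂ := ⋃ w ∈ W,
    {p : (V → ℤˣ) × Noise V | factor G β k t p.2 w ≠ run G β p.1 t p.2 w}) ?_
    (measure_ne_top _ _)).trans ?_
  · intro p hp
    by_contra hcon
    have heq : ∀ w ∈ (W : Set V), run G β p.1 t p.2 w = factor G β k t p.2 w := fun w hw => by
      by_contra hne
      exact hcon (Set.mem_biUnion hw (Ne.symm hne))
    have := hW heq
    simp only [Set.mem_symmDiff, Set.mem_preimage] at hp
    simp only [eq_iff_iff] at this
    tauto
  · refine (measureReal_biUnion_finset_le _ _).trans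
      ((Finset.sum_le_card_nsmul _ _ ((N * p) ^ k + mixingRate N p ^ t) fun w _ => ?_).trans
        (nsmul_eq_mul _ _).le)
    -- The contraction bound is uniform in the initial state and is integrated over it.
    rw [measureReal_def, Measure.prod_apply (hD w)]
    refine ENNReal.toReal_le_of_le_ofReal hb ?_
    refine (lintegral_mono (g := fun _ => ENNReal.ofReal ((N * p) ^ k + mixingRate N p ^ t))
      fun x => ?_).trans (by simp)
    refine ENNReal.le_ofReal_iff_toReal_le (measure_ne_top _ _) hb |>.2 ?_
    exact measure_factor_ne_run_le G hdeg hp0 hp1 hp hq x k t w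

end Glauber

/-! ### Finite-volume Gibbs measures -/

namespace PeriodicTriangulation

variable (T : PeriodicTriangulation) (β : ℝ) (Λ : Finset T.Vertex)

/-- The weight of a configuration in the Ising measure. -/
noncomputable def gibbsWeight (ω : T.Config) (σ : Λ → ℤˣ) : ℝ :=
  Real.exp (-β * T.hamiltonian Λ ω σ) / T.partitionFunction β Λ ω

lemma partitionFunction_pos (ω : T.Config) : 0 < T.partitionFunction β Λ ω := by
  unfold partitionFunction
  exact Finset.sum_pos (fun σ _ => Real.exp_pos _) ⟨1, Finset.mem_univ _⟩

lemma gibbsWeight_nonneg (ω : T.Config) (σ : Λ → ℤˣ) : 0 ≤ T.gibbsWeight β Λ ω σ :=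
  div_nonneg (Real.exp_pos _).le (T.partitionFunction_pos β Λ ω).le

open Classical in
lemma sum_gibbsWeight (ω : T.Config) : ∑ σ, T.gibbsWeight β Λ ω σ = 1 := by
  unfold gibbsWeight
  rw [← Finset.sum_div]
  exact div_self (T.partitionFunction_pos β Λ ω).ne'

open Classical in
lemma isingMeasure_apply (ω : T.Config) (S : Set (Λ → ℤˣ)) :
    T.isingMeasure β Λ ω S =
      ∑ σ, if σ ∈ S then ENNReal.ofReal (T.gibbsWeight β Λ ω σ) else 0 := by
  unfold isingMeasure
  rw [Measure.finsetSum_apply]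
  refine Finset.sum_congr rfl fun σ _ => ?_
  rw [Measure.smul_apply, Measure.dirac_apply' _ S.toFinite.measurableSet]
  by_cases h : σ ∈ S <;> simp [h, gibbsWeight]

instance (ω : T.Config) : IsProbabilityMeasure (T.isingMeasure β Λ ω) := by
  classical
  constructor
  rw [isingMeasure_apply]
  simp only [Set.mem_univ, if_true]
  rw [← ENNReal.ofReal_sum_of_nonneg fun σ _ => T.gibbsWeight_nonneg β Λ ω σ,
    sum_gibbsWeight, ENNReal.ofReal_one]

variable {T Λ}

lemma glue_of_mem {σ : Λ → ℤˣ} {ω : T.Config} {v : T.Vertex} (h : v ∈ Λ) :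
    T.glue Λ σ ω v = σ ⟨v, h⟩ := by simp [glue, h]

lemma glue_of_notMem {σ : Λ → ℤˣ} {ω : T.Config} {v : T.Vertex} (h : v ∉ Λ) :
    T.glue Λ σ ω v = ω v := by simp [glue, h]

lemma glue_coe (σ : Λ → ℤˣ) (ω : T.Config) (v : Λ) : T.glue Λ σ ω v = σ v :=
  glue_of_mem v.2

lemma glue_restrict (ω : T.Config) : T.glue Λ (fun v => ω v) ω = ω := by
  funext v
  by_cases h : v ∈ Λ
  · rw [glue_of_mem h]
  · rw [glue_of_notMem h]

variable (T Λ) [T.graph.LocallyFinite]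

open Classical in
lemma finsum_boundary (i : T.Vertex) (f : T.Vertex → ℝ) :
    ∑ᶠ j ∈ {j : T.Vertex | j ∉ Λ ∧ T.graph.Adj i j}, f j =
      ∑ j ∈ T.graph.neighborFinset i, if j ∉ Λ then f j else 0 := by
  have : {j : T.Vertex | j ∉ Λ ∧ T.graph.Adj i j} =
      ((T.graph.neighborFinset i).filter fun j => j ∉ Λ : Finset T.Vertex) := by
    ext; simp [and_comm]
  rw [← Finset.sum_filter, this, finsum_mem_coe_finset]

/-- The sum of `ζ_i ζ_j` over the ordered pairs of neighbours in `U`, one of which is in `Λ`. -/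
noncomputable def interaction (U : Finset T.Vertex) (ζ : T.Config) : ℝ :=
  open Classical in ∑ i ∈ U, ∑ j ∈ U,
    if T.graph.Adj i j ∧ (i ∈ Λ ∨ j ∈ Λ) then ((ζ i : ℤ) : ℝ) * ((ζ j : ℤ) : ℝ) else 0

/-- Over ordered pairs the boundary edges also appear twice, so one factor `1/2` serves all edges.
Hamiltonians of different volumes become sums over the same set `U` and can be subtracted. -/
lemma hamiltonian_eq_interaction {U : Finset T.Vertex} (hΛ : Λ ⊆ U)
    (hU : ∀ v ∈ Λ, T.graph.neighborFinset v ⊆ U) (ω : T.Config) (σ : Λ → ℤˣ) :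
    T.hamiltonian Λ ω σ = -(1 / 2) * T.interaction Λ U (T.glue Λ σ ω) := by
  classical
  set s : T.Vertex → ℝ := fun v => ((T.glue Λ σ ω v : ℤ) : ℝ) with hs
  have hin : ∑ i : Λ, ∑ j : Λ,
      (if T.graph.Adj i j then ((σ i : ℤ) : ℝ) * ((σ j : ℤ) : ℝ) else 0) =
      ∑ i ∈ U, ∑ j ∈ U, if T.graph.Adj i j ∧ i ∈ Λ ∧ j ∈ Λ then s i * s j else 0 := by
    have h1 : ∀ i j : Λ, (if T.graph.Adj i j then ((σ i : ℤ) : ℝ) * ((σ j : ℤ) : ℝ) else 0) =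
        if T.graph.Adj i j then s i * s j else 0 := fun i j => by simp only [hs, glue_coe]
    simp only [h1]
    rw [Finset.sum_coe_sort Λ fun i => ∑ j : Λ, if T.graph.Adj i j then s i * s j else 0]
    rw [← Finset.sum_subset hΛ (f := fun i => ∑ j ∈ U,
      if T.graph.Adj i j ∧ i ∈ Λ ∧ j ∈ Λ then s i * s j else 0)
      (fun i _ hi => by simp [hi])]
    refine Finset.sum_congr rfl fun i hi => ?_
    rw [Finset.sum_coe_sort Λ fun j => if T.graph.Adj i j then s i * s j else 0]
    rw [← Finset.sum_subset hΛ (f := fun j =>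
      if T.graph.Adj i j ∧ i ∈ Λ ∧ j ∈ Λ then s i * s j else 0)
      (fun j _ hj => by simp [hj])]
    exact Finset.sum_congr rfl fun j hj => by simp [hi, hj]
  have hout : ∑ i : Λ, ∑ᶠ j ∈ {j : T.Vertex | j ∉ Λ ∧ T.graph.Adj i j},
      ((σ i : ℤ) : ℝ) * ((ω j : ℤ) : ℝ) =
      ∑ i ∈ U, ∑ j ∈ U, if T.graph.Adj i j ∧ i ∈ Λ ∧ j ∉ Λ then s i * s j else 0 := by
    have h1 : ∀ i : Λ, ∑ᶠ j ∈ {j : T.Vertex | j ∉ Λ ∧ T.graph.Adj i j},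
        ((σ i : ℤ) : ℝ) * ((ω j : ℤ) : ℝ) =
        ∑ j ∈ T.graph.neighborFinset i, if j ∉ Λ then s i * s j else 0 := fun i => by
      rw [finsum_boundary]
      refine Finset.sum_congr rfl fun j _ => ?_
      by_cases hj : j ∈ Λ
      · simp [hj]
      · simp only [hs, glue_coe, glue_of_notMem hj]
    simp only [h1]
    rw [Finset.sum_coe_sort Λ fun i => ∑ j ∈ T.graph.neighborFinset i,
      if j ∉ Λ then s i * s j else 0]
    rw [← Finset.sum_subset hΛ (f := fun i => ∑ j ∈ U,
      if T.graph.Adj i j ∧ i ∈ Λ ∧ j ∉ Λ then s i * s j else 0)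
      (fun i _ hi => by simp [hi])]
    refine Finset.sum_congr rfl fun i hi => ?_
    rw [← Finset.sum_subset (hU i hi) (f := fun j =>
      if T.graph.Adj i j ∧ i ∈ Λ ∧ j ∉ Λ then s i * s j else 0)
      (fun j _ hj => by
        rw [SimpleGraph.mem_neighborFinset] at hj
        simp [hj])]
    refine Finset.sum_congr rfl fun j hj => ?_
    rw [SimpleGraph.mem_neighborFinset] at hj
    simp [hi, hj]
  have hswap : ∑ i ∈ U, ∑ j ∈ U, (if T.graph.Adj i j ∧ i ∉ Λ ∧ j ∈ Λ then s i * s j else 0) =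
      ∑ i ∈ U, ∑ j ∈ U, if T.graph.Adj i j ∧ i ∈ Λ ∧ j ∉ Λ then s i * s j else 0 := by
    rw [Finset.sum_comm]
    refine Finset.sum_congr rfl fun i _ => Finset.sum_congr rfl fun j _ => ?_
    rw [T.graph.adj_comm, mul_comm]
    exact if_congr (and_congr_right fun _ => and_comm) rfl rfl
  have hsplit : T.interaction Λ U (T.glue Λ σ ω) =
      ∑ i ∈ U, ∑ j ∈ U, (if T.graph.Adj i j ∧ i ∈ Λ ∧ j ∈ Λ then s i * s j else 0) +
      ∑ i ∈ U, ∑ j ∈ U, (if T.graph.Adj i j ∧ i ∈ Λ ∧ j ∉ Λ then s i * s j else 0) +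
      ∑ i ∈ U, ∑ j ∈ U, (if T.graph.Adj i j ∧ i ∉ Λ ∧ j ∈ Λ then s i * s j else 0) := by
    simp only [interaction, ← Finset.sum_add_distrib]
    refine Finset.sum_congr rfl fun i _ => Finset.sum_congr rfl fun j _ => ?_
    by_cases hi : i ∈ Λ <;> by_cases hj : j ∈ Λ <;> simp [hi, hj, hs]
  rw [hsplit, hswap, hamiltonian, ← hin, ← hout]
  ring

variable {T Λ}

/-- The ratio of the Gibbs weights in two volumes does not depend on the spins in the smaller
one. -/
lemma exp_hamiltonian_mul_comm {Λ' : Finset T.Vertex} (h : Λ ⊆ Λ') {ζ ζ' : T.Config}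
    (hζ : ∀ v ∉ Λ, ζ v = ζ' v) :
    Real.exp (-β * T.hamiltonian Λ' ζ (fun v => ζ v)) *
      Real.exp (-β * T.hamiltonian Λ ζ' (fun v => ζ' v)) =
    Real.exp (-β * T.hamiltonian Λ' ζ' (fun v => ζ' v)) *
      Real.exp (-β * T.hamiltonian Λ ζ (fun v => ζ v)) := by
  classical
  set U := Λ' ∪ Λ'.biUnion fun v => T.graph.neighborFinset v
  have h1 : Λ' ⊆ U := Finset.subset_union_left
  have h2 : ∀ v ∈ Λ', T.graph.neighborFinset v ⊆ U := fun v hv =>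
    (Finset.subset_biUnion_of_mem (fun v => T.graph.neighborFinset v) hv).trans
      Finset.subset_union_right
  -- The difference involves only pairs outside `Λ`, where `ζ` and `ζ'` agree.
  have key : ∀ ξ : T.Config, T.interaction Λ' U ξ - T.interaction Λ U ξ =
      ∑ i ∈ U, ∑ j ∈ U, if T.graph.Adj i j ∧ (i ∈ Λ' ∨ j ∈ Λ') ∧ i ∉ Λ ∧ j ∉ Λ
        then ((ξ i : ℤ) : ℝ) * ((ξ j : ℤ) : ℝ) else 0 := fun ξ => by
    simp only [interaction, ← Finset.sum_sub_distrib]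
    refine Finset.sum_congr rfl fun i _ => Finset.sum_congr rfl fun j _ => ?_
    have := @h i
    have := @h j
    by_cases hi : i ∈ Λ <;> by_cases hj : j ∈ Λ <;> simp_all
  have hkey : T.interaction Λ' U ζ - T.interaction Λ U ζ =
      T.interaction Λ' U ζ' - T.interaction Λ U ζ' := by
    rw [key, key]
    refine Finset.sum_congr rfl fun i _ => Finset.sum_congr rfl fun j _ => ?_
    split_ifs with hc
    · rw [hζ i hc.2.2.1, hζ j hc.2.2.2]
    · rfl
  rw [← Real.exp_add, ← Real.exp_add]
  simp only [T.hamiltonian_eq_interaction Λ' h1 h2,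
    T.hamiltonian_eq_interaction Λ (h.trans h1) fun v hv => h2 v (h hv), glue_restrict]
  congr 1
  linear_combination (β / 2) * hkey

lemma hamiltonian_congr {ω ω' : T.Config} (h : ∀ v ∉ Λ, ω v = ω' v) (σ : Λ → ℤˣ) :
    T.hamiltonian Λ ω σ = T.hamiltonian Λ ω' σ := by
  classical
  simp only [hamiltonian, finsum_boundary]
  congr 1
  refine Finset.sum_congr rfl fun i _ => Finset.sum_congr rfl fun j _ => ?_
  by_cases hj : j ∈ Λ
  · simp [hj]
  · rw [h j hj]

lemma partitionFunction_congr {ω ω' : T.Config} (h : ∀ v ∉ Λ, ω v = ω' v) :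
    T.partitionFunction β Λ ω = T.partitionFunction β Λ ω' := by
  simp only [partitionFunction, hamiltonian_congr h]

/-- In an independent set, the Hamiltonian is a sum over the vertices. -/
lemma hamiltonian_of_independent (h : ∀ a ∈ Λ, ∀ b ∈ Λ, ¬ T.graph.Adj a b) (ω : T.Config)
    (σ : Λ → ℤˣ) :
    T.hamiltonian Λ ω σ =
      -∑ i : Λ, ((σ i : ℤ) : ℝ) * Glauber.localField T.graph ω i := by
  classical
  have h1 : ∀ i j : Λ, ¬ T.graph.Adj i j := fun i j => h i i.2 j j.2
  simp only [hamiltonian, finsum_boundary, h1, if_false, Finset.sum_const_zero, mul_zero,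
    neg_zero, zero_sub, Glauber.localField, Finset.mul_sum]
  congr 1
  refine Finset.sum_congr rfl fun i _ => Finset.sum_congr rfl fun j hj => ?_
  rw [SimpleGraph.mem_neighborFinset] at hj
  rw [if_pos fun hj' => h i i.2 j hj' hj]

/-- Without internal edges the exponential and the partition function factorise over the vertices,
and each factor is a heat bath probability. -/
lemma gibbsWeight_of_independent (h : ∀ a ∈ Λ, ∀ b ∈ Λ, ¬ T.graph.Adj a b) (ω : T.Config)
    (τ : T.Config) :
    ENNReal.ofReal (T.gibbsWeight β Λ ω fun v => τ v) =
      ∏ v ∈ Λ, siteLaw {u | heatBath (β * Glauber.localField T.graph ω v) u = τ v} := by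
  classical
  have hexp : ∀ σ : Λ → ℤˣ, Real.exp (-β * T.hamiltonian Λ ω σ) =
      ∏ i : Λ, Real.exp (((σ i : ℤ) : ℝ) * (β * Glauber.localField T.graph ω i)) := fun σ => by
    rw [hamiltonian_of_independent h, ← Real.exp_sum, neg_mul_neg, Finset.mul_sum]
    congr 1
    exact Finset.sum_congr rfl fun i _ => by ring
  have hu : ∀ f : ℤˣ → ℝ, ∑ u, f u = f 1 + f (-1) := fun f => by
    rw [show (Finset.univ : Finset ℤˣ) = {1, -1} by decide,
      Finset.sum_pair (by decide)]
  have hZ : T.partitionFunction β Λ ω = ∏ i : Λ,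
      (Real.exp (β * Glauber.localField T.graph ω i) +
        Real.exp (-(β * Glauber.localField T.graph ω i))) := by
    have := Finset.prod_univ_sum (fun _ : Λ => (Finset.univ : Finset ℤˣ)) fun i u =>
      Real.exp (((u : ℤ) : ℝ) * (β * Glauber.localField T.graph ω i))
    rw [Fintype.piFinset_univ] at this
    simp only [hu] at this
    simp only [partitionFunction, hexp]
    rw [← this]
    simp
  simp only [siteLaw_heatBath]
  rw [gibbsWeight, hexp, hZ, ← Finset.prod_div_distrib,
    Finset.prod_coe_sort Λ fun i => Real.exp (((τ i : ℤ) : ℝ) *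
      (β * Glauber.localField T.graph ω i)) / (Real.exp (β * Glauber.localField T.graph ω i) +
        Real.exp (-(β * Glauber.localField T.graph ω i))),
    ENNReal.ofReal_prod_of_nonneg fun i _ => by positivity]

/-- Gibbs measures are invariant under heat bath updates. -/
lemma IsGibbs.heatBathInvariant {β : ℝ} {μ : Measure T.Config} (hμ : T.IsGibbs β μ) :
    Glauber.HeatBathInvariant T.graph β μ := by
  classical
  intro W J τ hJ hind
  have hC : MeasurableSet {y : T.Config | ∀ w ∈ W, y w = τ w} := by
    simpa using Glauber.measurableSet_cylinder W τ fun _ => True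
  rw [← hμ.2 J _ hC, ← lintegral_indicator (Glauber.measurableSet_cylinder W τ _)]
  refine lintegral_congr fun ω => ?_
  rw [isingMeasure_apply]
  by_cases hω : ∀ w ∈ W, w ∉ J → ω w = τ w
  · rw [Set.indicator_of_mem (s := {y : T.Config | ∀ w ∈ W, w ∉ J → y w = τ w}) hω,
      -- As `J` lies in `W`, the cylinder fixes all resampled spins and one term survives.
      ← gibbsWeight_of_independent β hind, Finset.sum_eq_single fun v : J => τ v]
    · rw [if_pos]
      intro w hw
      by_cases hwJ : w ∈ J
      · rw [glue_of_mem hwJ]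
      · rw [glue_of_notMem hwJ, hω w hw hwJ]
    · intro σ _ hσ
      refine if_neg fun hmem => hσ (funext fun v => ?_)
      have := hmem v (hJ v.2)
      rwa [glue_coe] at this
    · simp
  · rw [Set.indicator_of_notMem (s := {y : T.Config | ∀ w ∈ W, w ∉ J → y w = τ w}) hω,
      Finset.sum_eq_zero]
    intro σ _
    refine if_neg fun hmem => hω fun w hw hwJ => ?_
    have := hmem w hw
    rwa [glue_of_notMem hwJ] at this

end PeriodicTriangulation

/-! ### Existence of Gibbs measures -/

namespace PeriodicTriangulation

variable {T : PeriodicTriangulation} (β : ℝ) (Λ : Finset T.Vertex)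

lemma continuous_glue (σ : Λ → ℤˣ) : Continuous (T.glue Λ σ) := by
  refine continuous_pi fun v => ?_
  by_cases h : v ∈ Λ
  · simpa only [glue_of_mem h] using continuous_const
  · simpa only [glue_of_notMem h] using continuous_apply v

variable {Λ}

lemma isClopen_cylinder (Λ : Finset T.Vertex) (τ : T.Config) : IsClopen {y : T.Config | ∀ w ∈ Λ, y w = τ w} := by
  have : {y : T.Config | ∀ w ∈ Λ, y w = τ w} = ⋂ w ∈ Λ, (fun y => y w) ⁻¹' {τ w} := by
    ext; simp
  rw [this]
  exact isClopen_biInter_finset fun w _ => (isClopen_discrete _).preimage (continuous_apply w)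

/-- The Ising measure in a finite volume with all spins outside equal to `1`. -/
noncomputable def finiteVolume (β : ℝ) (Λ : Finset T.Vertex) : Measure T.Config :=
  (T.isingMeasure β Λ 1).map fun σ => T.glue Λ σ 1

instance : IsProbabilityMeasure (T.finiteVolume β Λ) :=
  Measure.isProbabilityMeasure_map (measurable_of_countable _).aemeasurable

open Classical in
lemma lintegral_isingMeasure (ω : T.Config) (f : (Λ → ℤˣ) → ENNReal) :
    ∫⁻ σ, f σ ∂T.isingMeasure β Λ ω = ∑ σ, ENNReal.ofReal (T.gibbsWeight β Λ ω σ) * f σ := by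
  unfold isingMeasure
  rw [lintegral_finsetSum_measure]
  refine Finset.sum_congr rfl fun σ _ => ?_
  rw [lintegral_smul_measure, lintegral_dirac]
  rfl

open Classical in
/-- Exchange of the spins in `Λ` between a configuration in `Λ'` and a configuration in `Λ`. -/
noncomputable def exchange (Λ Λ' : Finset T.Vertex) (h : Λ ⊆ Λ') :
    Equiv.Perm ((Λ' → ℤˣ) × (Λ → ℤˣ)) :=
  Function.Involutive.toPerm
    (fun p => (fun v => if hv : (v : T.Vertex) ∈ Λ then p.2 ⟨v, hv⟩ else p.1 v,
      fun v => p.1 ⟨v, h v.2⟩)) (fun p => by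
        refine Prod.ext (funext fun v => ?_) (funext fun v => ?_)
        · by_cases hv : (v : T.Vertex) ∈ Λ <;> simp [hv]
        · simp)

/-- The exchange turns an old configuration with its resampled spins into the new configuration,
remembering the old spins. -/
lemma glue_exchange {Λ Λ' : Finset T.Vertex} (h : Λ ⊆ Λ') (p : (Λ' → ℤˣ) × (Λ → ℤˣ))
    (ω : T.Config) :
    T.glue Λ' (exchange Λ Λ' h p).1 ω = T.glue Λ p.2 (T.glue Λ' p.1 ω) := by
  classical
  funext v
  by_cases hv : v ∈ Λ
  · rw [glue_of_mem hv, glue_of_mem (h hv)]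
    exact dif_pos hv
  · rw [glue_of_notMem hv]
    by_cases hv' : v ∈ Λ'
    · rw [glue_of_mem hv', glue_of_mem hv']
      exact dif_neg hv
    · rw [glue_of_notMem hv', glue_of_notMem hv']

variable [T.graph.LocallyFinite]

lemma continuous_hamiltonian (σ : Λ → ℤˣ) : Continuous fun ω => T.hamiltonian Λ ω σ := by
  classical
  simp only [hamiltonian, finsum_boundary]
  refine continuous_const.sub (continuous_finsetSum _ fun i _ => continuous_finsetSum _
    fun j _ => ?_)
  by_cases hj : j ∈ Λ
  · simpa [hj] using continuous_const
  · simp only [hj, not_false_eq_true, if_true]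
    exact continuous_const.mul ((continuous_of_discreteTopology (f := fun u : ℤˣ =>
      ((u : ℤ) : ℝ))).comp (continuous_apply j))

lemma continuous_gibbsWeight (σ : Λ → ℤˣ) : Continuous fun ω => T.gibbsWeight β Λ ω σ := by
  classical
  have h : ∀ σ : Λ → ℤˣ, Continuous fun ω => Real.exp (-β * T.hamiltonian Λ ω σ) := fun σ =>
    Real.continuous_exp.comp (continuous_const.mul (continuous_hamiltonian σ))
  refine (h σ).div ?_ fun ω => (T.partitionFunction_pos β Λ ω).ne'
  unfold partitionFunction
  exact continuous_finsetSum _ fun σ _ => h σ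

/-- Detailed balance. -/
lemma gibbsWeight_exchange {Λ Λ' : Finset T.Vertex} (h : Λ ⊆ Λ') (p : (Λ' → ℤˣ) × (Λ → ℤˣ))
    (ω : T.Config) :
    T.gibbsWeight β Λ' ω (exchange Λ Λ' h p).1 *
      T.gibbsWeight β Λ (T.glue Λ' (exchange Λ Λ' h p).1 ω) (exchange Λ Λ' h p).2 =
    T.gibbsWeight β Λ' ω p.1 * T.gibbsWeight β Λ (T.glue Λ' p.1 ω) p.2 := by
  set ζ := T.glue Λ' p.1 ω with hζ
  have hζ' : T.glue Λ' (exchange Λ Λ' h p).1 ω = T.glue Λ p.2 ζ := glue_exchange h p ω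
  have hoff : ∀ v ∉ Λ, ζ v = T.glue Λ p.2 ζ v := fun v hv => (glue_of_notMem hv).symm
  have hbig : ∀ σ : Λ' → ℤˣ, T.hamiltonian Λ' ω σ =
      T.hamiltonian Λ' (T.glue Λ' σ ω) fun v => T.glue Λ' σ ω v := fun σ => by
    simp only [glue_coe]
    exact hamiltonian_congr (fun v hv => (glue_of_notMem hv).symm) σ
  have h1 : (exchange Λ Λ' h p).2 = fun v : Λ => ζ v := by
    funext v
    rw [hζ, glue_of_mem (h v.2)]
    rfl
  have h2 : T.hamiltonian Λ ζ p.2 =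
      T.hamiltonian Λ (T.glue Λ p.2 ζ) fun v => T.glue Λ p.2 ζ v := by
    simp only [glue_coe]
    exact hamiltonian_congr hoff _
  have h3 : T.hamiltonian Λ (T.glue Λ p.2 ζ) (fun v => ζ v) =
      T.hamiltonian Λ ζ fun v => ζ v := hamiltonian_congr (fun v hv => (hoff v hv).symm) _
  have key := exp_hamiltonian_mul_comm β h hoff
  simp only [gibbsWeight]
  rw [hbig, hbig p.1, hζ', ← hζ, h1, h2, h3,
    ← partitionFunction_congr β hoff, div_mul_div_comm, div_mul_div_comm, key]

/-- The finite-volume measures satisfy the DLR equations in smaller volumes. -/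
lemma finiteVolume_dlr {Λ Λ' : Finset T.Vertex} (h : Λ ⊆ Λ') {A : Set T.Config}
    (hA : MeasurableSet A) (hm : Measurable fun ω => T.isingMeasure β Λ ω {σ | T.glue Λ σ ω ∈ A}) :
    ∫⁻ ω, T.isingMeasure β Λ ω {σ | T.glue Λ σ ω ∈ A} ∂T.finiteVolume β Λ' =
      T.finiteVolume β Λ' A := by
  classical
  rw [finiteVolume, lintegral_map hm (measurable_of_countable _), lintegral_isingMeasure,
    Measure.map_apply (measurable_of_countable _) hA, isingMeasure_apply]
  simp only [isingMeasure_apply, Finset.mul_sum, Set.mem_ofPred_eq, Set.mem_preimage]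
  have h1 : ∀ (σ' : Λ' → ℤˣ) (σ : Λ → ℤˣ),
      ENNReal.ofReal (T.gibbsWeight β Λ' 1 σ') *
        (if T.glue Λ σ (T.glue Λ' σ' 1) ∈ A then
          ENNReal.ofReal (T.gibbsWeight β Λ (T.glue Λ' σ' 1) σ) else 0) =
      (fun p : (Λ' → ℤˣ) × (Λ → ℤˣ) => if T.glue Λ' p.1 1 ∈ A then
        ENNReal.ofReal (T.gibbsWeight β Λ' 1 p.1 * T.gibbsWeight β Λ (T.glue Λ' p.1 1) p.2)
        else 0) (exchange Λ Λ' h (σ', σ)) := fun σ' σ => by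
    beta_reduce
    rw [gibbsWeight_exchange, glue_exchange]
    split_ifs
    · rw [ENNReal.ofReal_mul (T.gibbsWeight_nonneg β Λ' _ _)]
    · simp
  simp only [h1]
  -- Reindexing by the exchange makes the event depend on the first component only; the weights of
  -- the second then sum to `1`.
  rw [← Fintype.sum_prod_type']
  refine (Equiv.sum_comp (exchange Λ Λ' h) (fun p : (Λ' → ℤˣ) × (Λ → ℤˣ) =>
    if T.glue Λ' p.1 1 ∈ A then ENNReal.ofReal
      (T.gibbsWeight β Λ' 1 p.1 * T.gibbsWeight β Λ (T.glue Λ' p.1 1) p.2) else 0)).trans ?_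
  rw [Fintype.sum_prod_type]
  refine Finset.sum_congr rfl fun σ' _ => ?_
  dsimp only
  split_ifs
  · rw [← ENNReal.ofReal_sum_of_nonneg fun σ _ =>
      mul_nonneg (T.gibbsWeight_nonneg β Λ' _ _) (T.gibbsWeight_nonneg β Λ _ _),
      ← Finset.mul_sum, sum_gibbsWeight, mul_one]
  · simp

/-- The kernels preserve continuity, as they depend on finitely many boundary spins; this lets the
DLR equations pass to weak limits. -/
lemma continuous_isingMeasure_glue {A : Set T.Config} (hA : IsClopen A) :
    Continuous fun ω => (T.isingMeasure β Λ ω).real {σ | T.glue Λ σ ω ∈ A} := by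
  classical
  have : (fun ω => (T.isingMeasure β Λ ω).real {σ | T.glue Λ σ ω ∈ A}) = fun ω =>
      ∑ σ, Set.indicator (T.glue Λ σ ⁻¹' A) (fun ω => T.gibbsWeight β Λ ω σ) ω := by
    funext ω
    rw [measureReal_def, isingMeasure_apply, ENNReal.toReal_sum fun σ _ => by
      split_ifs <;> simp]
    refine Finset.sum_congr rfl fun σ _ => ?_
    by_cases h : T.glue Λ σ ω ∈ A
    · simp [h, ENNReal.toReal_ofReal (T.gibbsWeight_nonneg β Λ ω σ)]
    · simp [h]
  rw [this]
  exact continuous_finsetSum _ fun σ _ =>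
    (hA.preimage (continuous_glue Λ σ)).continuous_indicator (continuous_gibbsWeight β σ)

variable [Countable T.Vertex]

lemma measurable_isingMeasure_glue {A : Set T.Config} (hA : MeasurableSet A) :
    Measurable fun ω => T.isingMeasure β Λ ω {σ | T.glue Λ σ ω ∈ A} := by
  classical
  simp only [isingMeasure_apply, Set.mem_ofPred_eq]
  refine Finset.measurable_fun_sum _ fun σ _ => ?_
  exact Measurable.ite ((continuous_glue Λ σ).measurable hA)
    (continuous_gibbsWeight β σ).measurable.ennreal_ofReal measurable_const

open Classical in
/-- The measure obtained from `μ` by resampling the configuration in `Λ`. -/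
noncomputable def resample (β : ℝ) (Λ : Finset T.Vertex) (μ : Measure T.Config) :
    Measure T.Config :=
  ∑ σ : Λ → ℤˣ,
    (μ.withDensity fun ω => ENNReal.ofReal (T.gibbsWeight β Λ ω σ)).map (T.glue Λ σ)

/-- Turns the DLR equation in `Λ` into an equality of measures, which need only be checked on
cylinders. -/
lemma resample_apply (μ : Measure T.Config) {A : Set T.Config} (hA : MeasurableSet A) :
    resample β Λ μ A = ∫⁻ ω, T.isingMeasure β Λ ω {σ | T.glue Λ σ ω ∈ A} ∂μ := by
  classical
  have hg : ∀ σ : Λ → ℤˣ, Measurable (T.glue Λ σ) := fun σ => (continuous_glue Λ σ).measurable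
  simp only [isingMeasure_apply, Set.mem_ofPred_eq]
  rw [lintegral_finsetSum, resample, Measure.finsetSum_apply]
  · refine Finset.sum_congr rfl fun σ _ => ?_
    rw [Measure.map_apply (hg σ) hA, withDensity_apply _ (hg σ hA),
      ← lintegral_indicator (hg σ hA)]
    exact lintegral_congr fun ω => by simp [Set.indicator]
  · exact fun σ _ => Measurable.ite (hg σ hA)
      (continuous_gibbsWeight β σ).measurable.ennreal_ofReal measurable_const

lemma isProbabilityMeasure_resample (μ : Measure T.Config) [IsProbabilityMeasure μ] :
    IsProbabilityMeasure (resample β Λ μ) :=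
  ⟨by rw [resample_apply β μ MeasurableSet.univ]; simp⟩

variable (T) in
/-- There is a Gibbs measure, by compactness. -/
theorem exists_isGibbs : ∃ μ : Measure T.Config, T.IsGibbs β μ := by
  classical
  let γ : Finset T.Vertex → ProbabilityMeasure T.Config := fun Λ =>
    ⟨T.finiteVolume β Λ, inferInstance⟩
  -- An ultrafilter finer than `atTop` gives a limit of the finite-volume measures along growing
  -- volumes, without extracting subsequences.
  let F : Ultrafilter (Finset T.Vertex) := Ultrafilter.of Filter.atTop
  obtain ⟨μ, -, hμ⟩ := isCompact_univ.ultrafilter_le_nhds (F.map γ) (by simp)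
  have hF : (F : Filter (Finset T.Vertex)) ≤ Filter.atTop := Ultrafilter.of_le _
  have hlim := ProbabilityMeasure.tendsto_iff_forall_integral_tendsto.1 (show
    Filter.Tendsto γ F (nhds μ) from hμ)
  refine ⟨μ, inferInstance, fun Λ A hA => ?_⟩
  have := isProbabilityMeasure_resample (Λ := Λ) β (μ : Measure T.Config)
  rw [← resample_apply β _ hA]
  congr 1
  refine measure_ext_of_cylinders fun W τ => ?_
  have hC := isClopen_cylinder W τ
  have hCm := hC.isOpen.measurableSet
  set C := {y : T.Config | ∀ w ∈ W, y w = τ w}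
  have hreal : ∀ ν : Measure T.Config, IsProbabilityMeasure ν →
      ∫ ω, (T.isingMeasure β Λ ω).real {σ | T.glue Λ σ ω ∈ C} ∂ν =
        (∫⁻ ω, T.isingMeasure β Λ ω {σ | T.glue Λ σ ω ∈ C} ∂ν).toReal := fun ν _ =>
    integral_toReal (measurable_isingMeasure_glue β hCm).aemeasurable
      (Filter.Eventually.of_forall fun ω => measure_lt_top _ _)
  have h1 := hlim (BoundedContinuousFunction.mkOfCompact
    ⟨_, continuous_isingMeasure_glue (Λ := Λ) β hC⟩)
  have h2 := hlim (BoundedContinuousFunction.mkOfCompact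
    ⟨_, hC.continuous_indicator (continuous_const (y := (1 : ℝ)))⟩)
  simp only [BoundedContinuousFunction.mkOfCompact_apply, ContinuousMap.coe_mk] at h1 h2
  simp only [integral_indicator_const _ hCm, smul_eq_mul, mul_one] at h2
  have heq : ∀ᶠ Λ' in (F : Filter (Finset T.Vertex)),
      ∫ ω, (T.isingMeasure β Λ ω).real {σ | T.glue Λ σ ω ∈ C} ∂(γ Λ' : Measure T.Config) =
        (γ Λ' : Measure T.Config).real C := by
    filter_upwards [hF (Filter.eventually_ge_atTop Λ)] with Λ' hΛ'
    rw [hreal _ inferInstance]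
    exact congrArg ENNReal.toReal
      (finiteVolume_dlr β hΛ' hCm (measurable_isingMeasure_glue β hCm))
  have hfin := tendsto_nhds_unique (h1.congr' heq) h2
  rw [hreal _ inferInstance, ← resample_apply β _ hCm] at hfin
  exact (measureReal_eq_measureReal_iff).1 hfin

end PeriodicTriangulation

/-! ### Uniqueness, symmetry and approximation of Gibbs measures -/

lemma tvDist_nonneg {α : Type*} [MeasurableSpace α] (μ ν : Measure α) : 0 ≤ tvDist μ ν :=
  Real.iSup_nonneg fun _ => abs_nonneg _

lemma tvDist_le {α : Type*} [MeasurableSpace α] {μ ν : Measure α} {d : ℝ}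
    (h : ∀ A, MeasurableSet A → |μ.real A - ν.real A| ≤ d) : tvDist μ ν ≤ d :=
  have : Nonempty {A : Set α // MeasurableSet A} := ⟨⟨∅, MeasurableSet.empty⟩⟩
  ciSup_le fun A => h A.1 A.2

/-- Probability measures that have the same approximations on cylinders are equal. -/
lemma measure_ext_of_approximation {V : Type*} {μ μ' : Measure (V → ℤˣ)}
    [IsFiniteMeasure μ] [IsFiniteMeasure μ'] {ν : ℕ → Measure (V → ℤˣ)} {ε : ℕ → ℝ}
    (hε : Filter.Tendsto ε Filter.atTop (nhds 0))
    (h : ∀ (W : Finset V) (τ : V → ℤˣ), ∃ K : ℝ, ∀ k,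
      |μ.real {y | ∀ w ∈ W, y w = τ w} - (ν k).real {y | ∀ w ∈ W, y w = τ w}| ≤ K * ε k)
    (h' : ∀ (W : Finset V) (τ : V → ℤˣ), ∃ K : ℝ, ∀ k,
      |μ'.real {y | ∀ w ∈ W, y w = τ w} - (ν k).real {y | ∀ w ∈ W, y w = τ w}| ≤ K * ε k) :
    μ = μ' := by
  refine measure_ext_of_cylinders fun W τ => (measureReal_eq_measureReal_iff).1 ?_
  obtain ⟨K, hK⟩ := h W τ
  obtain ⟨K', hK'⟩ := h' W τ
  have hlim : ∀ K : ℝ, Filter.Tendsto (fun k => K * ε k) Filter.atTop (nhds 0) := fun K => by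
    simpa using hε.const_mul K
  have h1 := squeeze_zero (fun _ => abs_nonneg _) hK (hlim K)
  have h2 := squeeze_zero (fun _ => abs_nonneg _) hK' (hlim K')
  have h3 := ((tendsto_zero_iff_abs_tendsto_zero _).2 h1).sub
    ((tendsto_zero_iff_abs_tendsto_zero _).2 h2)
  simp only [sub_sub_sub_cancel_right, sub_zero] at h3
  exact sub_eq_zero.1 (tendsto_nhds_unique tendsto_const_nhds h3)

namespace PeriodicTriangulation

variable {T : PeriodicTriangulation} {N : ℕ} {β β₀ : ℝ}

lemma measurable_domRestrict (B : Set T.Vertex) :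
    Measurable (B.domRestrict : T.Config → B → ℤˣ) :=
  measurable_pi_lambda _ fun _ => measurable_pi_apply _

variable [T.graph.LocallyFinite]

variable (T) in
/-- The law of the truncated Glauber dynamics. -/
noncomputable def factorLaw (β : ℝ) (k t : ℕ) : Measure T.Config :=
  (Glauber.noiseLaw T.Vertex).map (Glauber.factor T.graph β k t)

instance (k t : ℕ) : IsProbabilityMeasure (T.factorLaw β k t) :=
  Measure.isProbabilityMeasure_map (Glauber.measurable_factor T.graph β k t).aemeasurable

lemma isSymmetricModel_factorLaw (β : ℝ) (k t : ℕ) : T.IsSymmetricModel (T.factorLaw β k t) :=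
  ⟨fun g hg => Glauber.factor_map_comp T.graph β (moveVertexIso g.toEquiv hg) k t,
    Glauber.factor_map_neg T.graph β k t⟩

lemma isDependent_factorLaw (β : ℝ) {k : ℕ} (t : ℕ) {ℓ : ℝ} (h : 2 * k < ℓ) :
    T.IsDependent ℓ (T.factorLaw β k t) := fun _ _ hAB =>
  Glauber.indepFun_factor T.graph β k t fun a ha b hb => by
    exact_mod_cast h.trans_le (hAB a ha b hb)

lemma tanh_abs_mul_le (hβ : β ∈ Set.Icc (-β₀) β₀) :
    Real.tanh (|β| * N) ≤ Real.tanh (β₀ * N) :=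
  Real.tanh_mono (mul_le_mul_of_nonneg_right (abs_le.2 hβ) (Nat.cast_nonneg N))

lemma tanh_nonneg (hβ₀ : 0 < β₀) : 0 ≤ Real.tanh (β₀ * N) := by
  simpa using Real.tanh_mono (show 0 ≤ β₀ * N by positivity)

variable (hN : T.IsMaxDegree N) (hβ₀ : 0 < β₀) (hsmall : (N : ℝ) * Real.tanh (β₀ * N) < 1)
include hN hβ₀ hsmall

lemma IsGibbs.abs_sub_factorLaw_le {μ : Measure T.Config} (hμ : T.IsGibbs β μ)
    (hβ : β ∈ Set.Icc (-β₀) β₀) (k t : ℕ) {W : Finset T.Vertex}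
    {A : Set T.Config} (hA : MeasurableSet A) (hW : DependsOn (fun y => y ∈ A) W) :
    |μ.real A - (T.factorLaw β k t).real A| ≤ W.card *
      ((N * Real.tanh (β₀ * N)) ^ k + Glauber.mixingRate N (Real.tanh (β₀ * N)) ^ t) :=
  have := hμ.1
  hμ.heatBathInvariant.abs_sub_factor_le hN.card_neighborFinset_le (tanh_nonneg hβ₀)
    (Real.tanh_lt_one _).le (tanh_abs_mul_le hβ) hsmall k t hA hW

omit [T.graph.LocallyFinite] hN in
lemma tendsto_approximation_error :
    Filter.Tendsto (fun k : ℕ => (N * Real.tanh (β₀ * N)) ^ k +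
      Glauber.mixingRate N (Real.tanh (β₀ * N)) ^ k) Filter.atTop (nhds 0) := by
  have h0 : 0 ≤ Real.tanh (β₀ * N) := tanh_nonneg hβ₀
  simpa using (tendsto_pow_atTop_nhds_zero_of_lt_one (by positivity) hsmall).add
    (tendsto_pow_atTop_nhds_zero_of_lt_one (Glauber.mixingRate_nonneg h0)
      (Glauber.mixingRate_lt_one hsmall))

lemma IsGibbs.exists_approximation {μ : Measure T.Config} (hμ : T.IsGibbs β μ)
    (hβ : β ∈ Set.Icc (-β₀) β₀) {W : Finset T.Vertex} {A : Set T.Config} (hA : MeasurableSet A)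
    (hW : DependsOn (fun y => y ∈ A) W) : ∃ K : ℝ, ∀ k,
      |μ.real A - (T.factorLaw β k k).real A| ≤ K * ((N * Real.tanh (β₀ * N)) ^ k +
        Glauber.mixingRate N (Real.tanh (β₀ * N)) ^ k) :=
  ⟨_, fun k => hμ.abs_sub_factorLaw_le hN hβ₀ hsmall hβ k k hA hW⟩

omit [T.graph.LocallyFinite] hN hβ₀ hsmall in
lemma dependsOn_cylinder (W : Finset T.Vertex) (τ : T.Config) :
    DependsOn (fun y => y ∈ {y : T.Config | ∀ w ∈ W, y w = τ w}) W := fun y y' h =>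
  propext (forall₂_congr fun w hw => by rw [h w hw])

/-- The approximating laws do not refer to the Gibbs measure, so any two Gibbs measures share them.
-/
lemma IsGibbs.eq {μ ν : Measure T.Config} (hμ : T.IsGibbs β μ) (hν : T.IsGibbs β ν)
    (hβ : β ∈ Set.Icc (-β₀) β₀) : μ = ν := by
  have := hμ.1
  have := hν.1
  exact measure_ext_of_approximation (tendsto_approximation_error hβ₀ hsmall)
    (fun W τ => hμ.exists_approximation hN hβ₀ hsmall hβ
      (isClopen_cylinder W τ).isOpen.measurableSet (dependsOn_cylinder W τ))
    (fun W τ => hν.exists_approximation hN hβ₀ hsmall hβ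
      (isClopen_cylinder W τ).isOpen.measurableSet (dependsOn_cylinder W τ))

/-- The symmetries of the truncated dynamics are symmetries of the Gibbs measure. -/
lemma IsGibbs.map_eq_self {μ : Measure T.Config} (hμ : T.IsGibbs β μ)
    (hβ : β ∈ Set.Icc (-β₀) β₀) {S : T.Config → T.Config} (hS : Measurable S)
    (hloc : ∀ v, ∃ w, DependsOn (fun y => S y v) {w})
    (hinv : ∀ k, (T.factorLaw β k k).map S = T.factorLaw β k k) : μ.map S = μ := by
  classical
  have := hμ.1
  have : IsProbabilityMeasure (μ.map S) := Measure.isProbabilityMeasure_map hS.aemeasurable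
  choose φ hφ using hloc
  refine measure_ext_of_approximation (tendsto_approximation_error hβ₀ hsmall) (fun W τ => ?_)
    fun W τ => hμ.exists_approximation hN hβ₀ hsmall hβ
      (isClopen_cylinder W τ).isOpen.measurableSet (dependsOn_cylinder W τ)
  have hC := (isClopen_cylinder W τ).isOpen.measurableSet
  -- The preimage of a cylinder under `S` still depends on finitely many spins, and the
  -- approximating laws do not distinguish it from the cylinder.
  obtain ⟨K, hK⟩ := hμ.exists_approximation hN hβ₀ hsmall hβ (hS hC) (W := W.image φ)
    fun y y' h => propext (forall₂_congr fun w hw => by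
      have : S y w = S y' w := hφ w fun i hi => h i (by
        rw [Set.mem_singleton_iff.1 hi]
        exact Finset.mem_coe.2 (Finset.mem_image_of_mem φ hw))
      rw [this])
  refine ⟨K, fun k => ?_⟩
  have := hK k
  rwa [← map_measureReal_apply hS hC, ← map_measureReal_apply hS hC, hinv k] at this

lemma IsGibbs.isSymmetricModel {μ : Measure T.Config} (hμ : T.IsGibbs β μ)
    (hβ : β ∈ Set.Icc (-β₀) β₀) : T.IsSymmetricModel μ := by
  refine ⟨fun g hg => ?_, ?_⟩
  · exact hμ.map_eq_self hN hβ₀ hsmall hβ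
      (measurable_pi_lambda _ fun v => measurable_pi_apply _)
      (fun v => ⟨T.moveVertex g hg v, fun y y' h => h _ rfl⟩)
      fun k => (isSymmetricModel_factorLaw β k k).1 g hg
  · exact hμ.map_eq_self hN hβ₀ hsmall hβ
      (measurable_pi_lambda _ fun v => (measurable_of_countable fun u : ℤˣ => -u).comp
        (measurable_pi_apply v))
      (fun v => ⟨v, fun y y' h => congrArg Neg.neg (h v rfl)⟩)
      fun k => (isSymmetricModel_factorLaw β k k).2

/-! ### Bounds on `theta` -/

omit [T.graph.LocallyFinite] hN hβ₀ hsmall in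
lemma theta_le_tvDist {μ ν : Measure T.Config} [IsProbabilityMeasure ν] {n ℓ : ℝ}
    (hs : T.IsSymmetricModel ν) (hd : T.IsDependent ℓ ν) :
    T.theta μ n ℓ ≤ tvDist (μ.map ((T.box n).domRestrict : T.Config → T.box n → ℤˣ))
      (ν.map ((T.box n).domRestrict : T.Config → T.box n → ℤˣ)) :=
  csInf_le ⟨0, by rintro _ ⟨ν, -, -, -, rfl⟩; exact tvDist_nonneg _ _⟩
    ⟨ν, inferInstance, hs, hd, rfl⟩

/-- The range depends on `k` only, so `t` remains free and can later be sent as far as needed. -/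
lemma IsGibbs.theta_le {μ : Measure T.Config} (hμ : T.IsGibbs β μ)
    (hβ : β ∈ Set.Icc (-β₀) β₀) {n ℓ : ℝ} {k : ℕ} (hk : 2 * k < ℓ) (t : ℕ) :
    T.theta μ n ℓ ≤ (T.box n).ncard * ((N * Real.tanh (β₀ * N)) ^ k +
      Glauber.mixingRate N (Real.tanh (β₀ * N)) ^ t) := by
  refine (theta_le_tvDist (isSymmetricModel_factorLaw β k t)
    (isDependent_factorLaw β t hk)).trans (tvDist_le fun A hA => ?_)
  have hm := measurable_domRestrict (T.box n)
  rw [map_measureReal_apply hm hA, map_measureReal_apply hm hA,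
    Set.ncard_eq_toFinset_card _ (T.finite_box n)]
  refine hμ.abs_sub_factorLaw_le hN hβ₀ hsmall hβ k t (hm hA) fun y y' h => ?_
  have : (T.box n).domRestrict y = (T.box n).domRestrict y' :=
    funext fun v => h v (by simp)
  simp only [Set.mem_preimage, this]

omit [T.graph.LocallyFinite] hN hβ₀ hsmall in
/-- Measures that are invariant under a change of signs agree on a single vertex. -/
lemma real_domRestrict_eq_of_subsingleton {μ ν : Measure T.Config} [IsProbabilityMeasure μ]
    [IsProbabilityMeasure ν] (hμ : μ.map (fun ω : T.Config => -ω) = μ)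
    (hν : ν.map (fun ω : T.Config => -ω) = ν) {B : Set T.Vertex} (hB : B.Subsingleton)
    {A : Set (B → ℤˣ)} (hA : MeasurableSet A) :
    μ.real ((B.domRestrict : T.Config → B → ℤˣ) ⁻¹' A) =
      ν.real ((B.domRestrict : T.Config → B → ℤˣ) ⁻¹' A) := by
  set E := (B.domRestrict : T.Config → B → ℤˣ) ⁻¹' A
  have hE : MeasurableSet E := measurable_domRestrict B hA
  have hn : Measurable fun ω : T.Config => -ω :=
    measurable_pi_lambda _ fun v => (measurable_of_countable fun u : ℤˣ => -u).comp
      (measurable_pi_apply v)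
  have hpm : ∀ ω : T.Config, (B.domRestrict ω = B.domRestrict (1 : T.Config)) ∨
      B.domRestrict (-ω) = B.domRestrict (1 : T.Config) := fun ω => by
    rcases hB.eq_empty_or_singleton with rfl | ⟨v, rfl⟩
    · exact Or.inl (funext fun v => v.2.elim)
    · rcases Int.units_eq_one_or (ω v) with h | h
      · exact Or.inl (funext fun w => by
          have : (w : T.Vertex) = v := w.2
          simp [this, h])
      · exact Or.inr (funext fun w => by
          have : (w : T.Vertex) = v := w.2
          simp [this, h])
  -- On at most one vertex, `ω` and `-ω` together exhaust the two constant signs. The sum is thus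
  -- constant, and its integral under a sign-invariant law is twice the probability of `E`.
  have hval : ∀ ω : T.Config, E.indicator (1 : T.Config → ℝ) ω + E.indicator 1 (-ω) =
      E.indicator (1 : T.Config → ℝ) 1 + E.indicator 1 (-1) := fun ω => by
    have hind : ∀ x y : T.Config, B.domRestrict x = B.domRestrict y →
        E.indicator (1 : T.Config → ℝ) x = E.indicator 1 y := fun x y h => by
      have hxy : x ∈ E ↔ y ∈ E := by
        show B.domRestrict x ∈ A ↔ B.domRestrict y ∈ A
        rw [h]
      by_cases hx : x ∈ E
      · simp [hx, hxy.1 hx]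
      · simp [hx, mt hxy.2 hx]
    have hneg : ∀ x y : T.Config, B.domRestrict x = B.domRestrict y →
        (B.domRestrict (-x) : B → ℤˣ) = B.domRestrict (-y) := fun x y h =>
      funext fun v => congrArg Neg.neg (congrFun h v)
    rcases hpm ω with h | h
    · rw [hind _ _ h, hind _ _ (hneg _ _ h)]
    · have h2 := hneg _ _ h
      rw [neg_neg] at h2
      rw [hind _ _ h, hind _ _ h2, add_comm]
  have key : ∀ ρ : Measure T.Config, IsProbabilityMeasure ρ →
      ρ.map (fun ω : T.Config => -ω) = ρ →
      2 * ρ.real E = E.indicator (1 : T.Config → ℝ) 1 + E.indicator 1 (-1) := fun ρ _ hρ => by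
    have hi : Integrable (E.indicator (1 : T.Config → ℝ)) ρ :=
      (integrable_const (1 : ℝ)).indicator hE
    have hi' : Integrable (fun ω : T.Config => E.indicator (1 : T.Config → ℝ) (-ω)) ρ :=
      (integrable_const (1 : ℝ)).indicator (hn hE)
    have h1 : ∫ ω, E.indicator (1 : T.Config → ℝ) ω ∂ρ = ρ.real E := integral_indicator_one hE
    have h2 : ∫ ω, E.indicator (1 : T.Config → ℝ) (-ω) ∂ρ = ρ.real E := by
      rw [← h1]
      conv_rhs => rw [← hρ]
      rw [integral_map hn.aemeasurable (by rw [hρ]; exact hi.aestronglyMeasurable)]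
    rw [two_mul]
    nth_rewrite 1 [← h1]
    rw [← h2, ← integral_add hi hi']
    simp only [hval]
    simp
  have h1 := key μ inferInstance hμ
  have h2 := key ν inferInstance hν
  linarith

/-- Needed because `n ^ 2` tends to `0` while a small box may still contain a vertex. The competitor
is the family of fair coins given by `k = 0`, admissible for every positive `ℓ`. -/
lemma IsGibbs.theta_nonpos_of_subsingleton {μ : Measure T.Config} (hμ : T.IsGibbs β μ)
    (hβ : β ∈ Set.Icc (-β₀) β₀) {n ℓ : ℝ} (hℓ : 0 < ℓ) (hn : (T.box n).Subsingleton) :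
    T.theta μ n ℓ ≤ 0 := by
  have := hμ.1
  refine (theta_le_tvDist (isSymmetricModel_factorLaw β 0 0)
    (isDependent_factorLaw β 0 (by simpa using hℓ))).trans (tvDist_le fun A hA => ?_)
  have hm := measurable_domRestrict (T.box n)
  rw [map_measureReal_apply hm hA, map_measureReal_apply hm hA,
    real_domRestrict_eq_of_subsingleton (hμ.isSymmetricModel hN hβ₀ hsmall hβ).2
      (isSymmetricModel_factorLaw β 0 0).2 hn hA, sub_self, abs_zero]

end PeriodicTriangulation

/-! ### Choice of the truncation depth and of the constant -/

theorem mainTheorem8 (T : PeriodicTriangulation) (N : ℕ) (hN : T.IsMaxDegree N)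
    (β₀ : ℝ) (hβ₀ : 0 < β₀) (hsmall : (N : ℝ) * Real.tanh (β₀ * N) < 1)
    (c : ℝ) (hc : c = -(1 / 2) * Real.log ((N : ℝ) * Real.tanh (β₀ * N))) :
    (∀ β ∈ Set.Icc (-β₀) β₀, ∃! μ : Measure T.Config, T.IsGibbs β μ) ∧
    (T.IsSymmetric → ∀ β ∈ Set.Icc (-β₀) β₀, ∀ μ : Measure T.Config,
      T.IsGibbs β μ → T.IsSymmetricModel μ) ∧
    0 < c ∧
    (∃ C : ℝ, ∀ β ∈ Set.Icc (-β₀) β₀, ∀ μ : Measure T.Config, T.IsGibbs β μ →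
      ∀ n ℓ : ℝ, 0 < ℓ → ℓ < n →
        T.theta μ n ℓ ≤ C * n ^ 2 * Real.exp (-c * ℓ)) := by
  let _ := hN.locallyFiniteGraph
  have hN0 : (0 : ℝ) < N := by exact_mod_cast hN.one_le
  have hp : 0 < Real.tanh (β₀ * N) := by
    rw [Real.tanh_eq_sinh_div_cosh]
    exact div_pos (Real.sinh_pos_iff.2 (by positivity)) (Real.cosh_pos _)
  set q := (N : ℝ) * Real.tanh (β₀ * N) with hq
  have hq0 : 0 < q := mul_pos hN0 hp
  have hlog : Real.log q < 0 := Real.log_neg hq0 hsmall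
  refine ⟨fun β hβ => ?_, fun _ β hβ μ hμ => hμ.isSymmetricModel hN hβ₀ hsmall hβ,
    by rw [hc]; linarith, ?_⟩
  · obtain ⟨μ, hμ⟩ := T.exists_isGibbs β
    exact ⟨μ, hμ, fun ν hν => hν.eq hN hβ₀ hsmall hμ hβ⟩
  · obtain ⟨r, hr, hbox⟩ := T.exists_subsingleton_box
    obtain ⟨K, hK, hcard⟩ := T.exists_ncard_box_le
    -- `K` counts vertices, `1 + 1 / r` replaces `n + 1` by a multiple of `n` when `n ≥ r`, the `2`
    -- absorbs the time term, and `q⁻¹` pays for rounding `ℓ / 2`.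
    refine ⟨K * (1 + 1 / r) ^ 2 * (2 * q⁻¹), fun β hβ μ hμ n ℓ hℓ hn => ?_⟩
    rcases lt_or_ge n r with hnr | hnr
    · exact (hμ.theta_nonpos_of_subsingleton hN hβ₀ hsmall hβ hℓ (hbox n hnr)).trans
        (by positivity)
    · have hn0 : 0 < n := hℓ.trans hn
      -- The largest `k` with `2k < ℓ`.
      obtain ⟨k, hk⟩ : ∃ k : ℕ, ⌈ℓ / 2⌉₊ = k + 1 :=
        Nat.exists_eq_succ_of_ne_zero (Nat.ceil_pos.2 (by linarith)).ne'
      have hk1 : 2 * (k : ℝ) < ℓ := by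
        have := (Nat.lt_ceil (n := k) (a := ℓ / 2)).1 (by omega)
        linarith
      have hk2 : ℓ / 2 ≤ k + 1 := by
        have := Nat.le_ceil (ℓ / 2)
        rw [hk] at this
        exact_mod_cast this
      -- The time is chosen so that the mixing error is below the truncation error.
      obtain ⟨t, ht⟩ := exists_pow_lt_of_lt_one (pow_pos hq0 k)
        (Glauber.mixingRate_lt_one hsmall)
      -- By the choice of `c`, `exp (-c * ℓ)` is `q` to the power `ℓ / 2`, and `k + 1 ≥ ℓ / 2` with
      -- `q < 1`.
      have hqk : q ^ k ≤ q⁻¹ * Real.exp (-c * ℓ) := by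
        rw [← Real.exp_log (pow_pos hq0 k), ← Real.exp_log (inv_pos.2 hq0), ← Real.exp_add,
          Real.log_pow, Real.log_inv, Real.exp_le_exp, hc]
        nlinarith
      have hnr' : n + 1 ≤ (1 + 1 / r) * n := by
        have : 1 ≤ n / r := (one_le_div hr).2 hnr
        have h2 : (1 + 1 / r) * n = n + n / r := by ring
        linarith
      calc T.theta μ n ℓ ≤ _ := hμ.theta_le hN hβ₀ hsmall hβ hk1 t
        _ ≤ (K * ((1 + 1 / r) * n) ^ 2) * (2 * (q⁻¹ * Real.exp (-c * ℓ))) := by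
          refine mul_le_mul ((hcard n hn0.le).trans ?_) ?_ ?_ (by positivity)
          · gcongr
          · linarith
          · have := Glauber.mixingRate_nonneg (N := N) hp.le
            positivity
        _ = _ := by ring
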